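/- **Conventions.** A literal over variables $x_1,\dots,x_n$ is a variable or its negation; $\mathrm{Lit}_n$ is the set of these literals. A clause is a finite set of literals (read as their disjunction), and a CNF formula is a conjunction of clauses. A *Resolution refutation* of a CNF formula $F$ is a sequence of clauses $D_1,\dots,D_t$ over the variables of $F$ with $D_t=\bot$ (the empty clause), in which each $D_i$ is a clause of $F$, or satisfies $D_i\supseteq D_j$ for some $j<i$ (weakening), or equals $A\vee B$ for earlier clauses $D_j=A\vee x$ and $D_k=B\vee\neg x$, $j,k<i$. **The formula $\mathrm{Ref}_s(\varphi)$.** Let $\varphi=C_1\wedge\dots\wedge C_m$ be a CNF formula over $x_1,\dots,x_n$ and $s\ge 1$. The variables of $\mathrm{Ref}_s(\varphi)$ are, for $B\in[s]$ (the *blocks*): $e^B$ (block $B$ is enabled), $d^B$ ($B$ is obtained by a Resolution step), $w^B_A$ for $A\in[m]$ ($B$ is a weakening of $C_A$), $p^B_\ell$ for $\ell\in\mathrm{Lit}_n$ (literal $\ell$ is present in $B$), $r^B_i$ for $i\in[n]$ ($B$ is obtained by resolving over $x_i$), and $L^B_{B'}$, $R^B_{B'}$ for $B'<B$ ($B$ is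 resolved on the left, respectively right, from block $B'$). It is the conjunction of the following clauses, written as implications, for all $B,B'\in[s]$ with $B'<B$, all $i\in[n]$, $A\in[m]$ and $\ell\in\mathrm{Lit}_n$: - $e^B\wedge r^B_i\wedge L^B_{B'}\wedge p^{B'}_\ell\to p^B_\ell$ if $\ell\ne x_i$; - $e^B\wedge r^B_i\wedge R^B_{B'}\wedge p^{B'}_\ell\to p^B_\ell$ if $\ell\neq\neg x_i$; - $e^B\wedge w^B_A\to p^B_\ell$ if $\ell\in C_A$; - $e^B\wedge d^B\to\bigvee_{i\in[n]}r^B_i$; $\quad e^B\wedge d^B\to\bigvee_{B''<B}L^B_{B''}$; $\quad e^B\wedge d^B\to\bigvee_{B''<B}R^B_{B''}$; $\quad e^B\wedge\neg d^B\to\bigvee_{A'\in[m]}w^B_{A'}$, for every $B\in[s]$; - $e^B\wedge L^B_{B'}\to e^{B'}$; $\quad e^B\wedge R^B_{B'}\to e^{B'}$; - $\neg p^s_\ell$; $\quad e^s$. **Search problems.** A search problem is a relation $R\subseteq\{0,1\}^*\times\{0,1\}^*$. It is in $\mathsf{FP}$ if there is a function $f:\{0,1\}^*\to\{0,1\}^*$,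 computable in polynomial time by a deterministic Turing machine, such that $(x,f(x))\in R$ for every $x$ for which some $y$ with $(x,y)\in R$ exists. $\mathsf{FPAP}_{\mathrm{Res}}[n^3]$ is the following search problem. *Input:* a CNF formula $\varphi$ over $n$ variables, a size parameter $s\ge\max(n^3,1)$ in unary, and a Resolution refutation $\pi$ of $\mathrm{Ref}_s(\varphi)$. *Output:* a satisfying assignment of $\varphi$ if $\varphi$ is satisfiable, and $0$ otherwise. Inputs are coded by binary strings in the standard way: $n$ and $s$ are given in unary, $\varphi$ and $\pi$ are sequences of clauses, and a clause is a list of its literals. **Theorem.** $\mathsf{FPAP}_{\mathrm{Res}}[n^3]\in\mathsf{FP}$. That is, there is a deterministic algorithm, running in time polynomial in the length of its input, which, given a CNF formula $\varphi$ over $n$ variables, $1^s$ with $s\ge n^3$ and $s\geq 1$, and a Resolution refutation $\pi$ of $\mathrm{Ref}_s(\varphi)$, outputs a satisfying assignment of $\varphi$ if $\varphi$ is satisfiable, and outputs $0$ if $\varphi$ is unsatisfiable. -/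

import Mathlib

/-! ## Search problems and polynomial time -/

namespace ProofAnalysis

/-- A search problem is a binary relation on `{0,1}*`. -/
abbrev SearchProblem := Set (List Bool × List Bool)

/-- A search problem `R` is in `FP` if some function computed in polynomial time by a (deterministic,
multi-stack) Turing machine outputs, on every input `x` that has a solution, a solution of `x`. -/
def InFP (R : SearchProblem) : Prop :=
  ∃ f : List Bool → List Bool,
    Nonempty (Turing.TM2ComputableInPolyTime (id : List Bool → List Bool) id f) ∧
      ∀ x, (∃ y, (x, y) ∈ R) → (x, f x) ∈ R

/-! ## Clauses and Resolution -/

/-- A literal: `(x, true)` is the variable `x`, and `(x, false)` is its negation. -/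
abbrev Literal (V : Type) := V × Bool

/-- The literal `x`. -/
abbrev pos {V : Type} (x : V) : Literal V := (x, true)

/-- The literal `¬x`. -/
abbrev neg {V : Type} (x : V) : Literal V := (x, false)

/-- A clause is a finite set of literals, read as their disjunction. -/
abbrev Clause (V : Type) := Finset (Literal V)

/-- The assignment `α` satisfies the clause `C`. -/
def SatisfiesClause {V : Type} (α : V → Bool) (C : Clause V) : Prop :=
  ∃ l ∈ C, α l.1 = l.2

/-- The assignment `α` satisfies the CNF formula `C₁ ∧ ⋯ ∧ Cₘ`. -/
def Satisfies {V : Type} {m : ℕ} (α : V → Bool) (φ : Fin m → Clause V) : Prop :=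
  ∀ A, SatisfiesClause α (φ A)

/-- `E` is obtained from `C` and `D` by the Resolution rule: from `A ∨ x` and `B ∨ ¬x`
infer `A ∨ B`. -/
def IsResolvent {V : Type} [DecidableEq V] (C D E : Clause V) : Prop :=
  ∃ (x : V) (A B : Clause V), C = insert (pos x) A ∧ D = insert (neg x) B ∧ E = A ∪ B

/-- `π` is a Resolution refutation of the conjunction of the clauses in `F`: its last clause is
empty, and each of its clauses is in `F`, or a weakening of an earlier clause, or obtained from two
earlier clauses by the Resolution rule. -/
structure IsRefutation {V : Type} [DecidableEq V] (F : Set (Clause V)) (π : List (Clause V)) :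
    Prop where
  last_empty : π.getLast? = some ∅
  derived : ∀ i : Fin π.length,
    π[i] ∈ F ∨
    (∃ j : Fin π.length, j < i ∧ π[j] ⊆ π[i]) ∨
    (∃ j k : Fin π.length, j < i ∧ k < i ∧ IsResolvent π[j] π[k] π[i])

/-! ## The formulas `Ref_s(φ)` -/

/-- The variables of `Ref_s(φ)`, for a fixed CNF formula `φ` with `n` variables and `m` clauses.
The blocks are numbered by `Fin s`, and the last one is the root. -/
inductive RefVar (n m s : ℕ) : Type
  /-- block `B` is enabled -/
  | enable (B : Fin s)
  /-- block `B` was obtained by a Resolution step -/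
  | derived (B : Fin s)
  /-- block `B` is a weakening of the clause `A` of `φ` -/
  | weak (B : Fin s) (A : Fin m)
  /-- the literal `l` is present in block `B` -/
  | lit (B : Fin s) (l : Literal (Fin n))
  /-- block `B` was obtained by resolving over the variable `i` -/
  | res (B : Fin s) (i : Fin n)
  /-- block `B` was resolved on the left from block `B'` -/
  | lpoint (B B' : Fin s) (h : B' < B)
  /-- block `B` was resolved on the right from block `B'` -/
  | rpoint (B B' : Fin s) (h : B' < B)
  deriving DecidableEq

open RefVar in
/-- The clauses of `Ref_s(φ)`. An implication `(a ∧ b) → c` is the clause `¬a ∨ ¬b ∨ c`. As `φ` is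
fixed, the variables of the general formula that describe `φ` carry their truth values, so that the
family `weak_lit` ranges over the literals that are present in the clause `A` of `φ`. -/
inductive RefClause {n m : ℕ} (s : ℕ) (φ : Fin m → Clause (Fin n)) : Clause (RefVar n m s) → Prop
  | left_lit (B B' : Fin s) (h : B' < B) (i : Fin n) (l : Literal (Fin n)) (hl : l ≠ pos i) :
      RefClause s φ
        {neg (enable B), neg (res B i), neg (lpoint B B' h), neg (lit B' l), pos (lit B l)}
  | right_lit (B B' : Fin s) (h : B' < B) (i : Fin n) (l : Literal (Fin n)) (hl : l ≠ neg i) :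
      RefClause s φ
        {neg (enable B), neg (res B i), neg (rpoint B B' h), neg (lit B' l), pos (lit B l)}
  | weak_lit (B : Fin s) (A : Fin m) (l : Literal (Fin n)) (hl : l ∈ φ A) :
      RefClause s φ {neg (enable B), neg (weak B A), pos (lit B l)}
  | must_resolve (B : Fin s) :
      RefClause s φ
        ({neg (enable B), neg (derived B)} ∪ Finset.univ.image fun i : Fin n => pos (res B i))
  | must_point_left (B : Fin s) :
      RefClause s φ
        ({neg (enable B), neg (derived B)} ∪
          Finset.univ.image fun B' : {B' : Fin s // B' < B} => pos (lpoint B B'.1 B'.2))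
  | must_point_right (B : Fin s) :
      RefClause s φ
        ({neg (enable B), neg (derived B)} ∪
          Finset.univ.image fun B' : {B' : Fin s // B' < B} => pos (rpoint B B'.1 B'.2))
  | must_weaken (B : Fin s) :
      RefClause s φ
        ({neg (enable B), pos (derived B)} ∪ Finset.univ.image fun A : Fin m => pos (weak B A))
  | enable_left (B B' : Fin s) (h : B' < B) :
      RefClause s φ {neg (enable B), neg (lpoint B B' h), pos (enable B')}
  | enable_right (B B' : Fin s) (h : B' < B) :
      RefClause s φ {neg (enable B), neg (rpoint B B' h), pos (enable B')}
  | root_empty (B : Fin s) (hB : B.val + 1 = s) (l : Literal (Fin n)) :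
      RefClause s φ {neg (lit B l)}
  | root_enabled (B : Fin s) (hB : B.val + 1 = s) :
      RefClause s φ {pos (enable B)}

/-- The CNF formula `Ref_s(φ)`, as its set of clauses. -/
def Ref {n m : ℕ} (s : ℕ) (φ : Fin m → Clause (Fin n)) : Set (Clause (RefVar n m s)) :=
  {C | RefClause s φ C}

/-! ## Binary encodings

All the codes below are self-delimiting. Indices are written in unary; as `n` and `s` are given in
unary and the clauses of `φ` are listed, this changes the input length only polynomially. -/

/-- The code `1ᵏ0` of `k`. -/
def encodeNat (k : ℕ) : List Bool := List.replicate k true ++ [false]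

/-- The code of a list: `1` in front of the code of each entry, and `0` at the end. -/
def encodeList {α : Type} (e : α → List Bool) : List α → List Bool
  | [] => [false]
  | a :: L => true :: (e a ++ encodeList e L)

/-- The code of a literal: its sign, followed by the code of its variable. -/
def encodeLiteral {V : Type} (e : V → List Bool) (l : Literal V) : List Bool := l.2 :: e l.1

/-- The code of a variable of `φ`. -/
def encodeVar {n : ℕ} (i : Fin n) : List Bool := encodeNat i

/-- The code of a variable of `Ref_s(φ)`: a tag of three bits for its kind, and its indices. -/
def encodeRefVar {n m s : ℕ} : RefVar n m s → List Bool
  | .enable B => [false, false, false] ++ encodeNat B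
  | .derived B => [false, false, true] ++ encodeNat B
  | .weak B A => [false, true, false] ++ encodeNat B ++ encodeNat A
  | .lit B l => [false, true, true] ++ encodeNat B ++ encodeLiteral encodeVar l
  | .res B i => [true, false, false] ++ encodeNat B ++ encodeVar i
  | .lpoint B B' _ => [true, false, true] ++ encodeNat B ++ encodeNat B'
  | .rpoint B B' _ => [true, true, false] ++ encodeNat B ++ encodeNat B'

/-- A sequence of clauses, each written as a list of its literals. -/
abbrev ClauseList (V : Type) := List (List (Literal V))

/-- The code of a sequence of clauses. -/
def encodeClauses {V : Type} (e : V → List Bool) (L : ClauseList V) : List Bool :=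
  encodeList (encodeList (encodeLiteral e)) L

/-- The CNF formula `C₁ ∧ ⋯ ∧ Cₘ` written as a sequence of clauses. -/
def ClauseList.toCNF {V : Type} [DecidableEq V] (L : ClauseList V) : Fin L.length → Clause V :=
  fun A => (L.get A).toFinset

/-- The code of an input `(φ, 1ˢ, π)`, where the CNF formula `φ` over `n` variables is given by `1ⁿ`
and the sequence of its clauses. -/
def encodeInput (n : ℕ) (φ : ClauseList (Fin n)) (s : ℕ)
    (π : ClauseList (RefVar n φ.length s)) : List Bool :=
  encodeNat n ++ encodeClauses encodeVar φ ++ encodeNat s ++ encodeClauses encodeRefVar π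

/-- The code of an output: `0` for "unsatisfiable", and `1α₁…αₙ` for the assignment `α`. -/
def encodeOutput {n : ℕ} : Option (Fin n → Bool) → List Bool
  | none => [false]
  | some α => true :: List.ofFn α

/-! ## The search version of the Proof Analysis Problem for Resolution -/

/-- `y` is a correct output for the CNF formula `φ`: a satisfying assignment of `φ` if there is one,
and "unsatisfiable" otherwise. -/
def IsCorrectOutput {n m : ℕ} (φ : Fin m → Clause (Fin n)) : Option (Fin n → Bool) → Prop
  | some α => Satisfies α φ
  | none => ¬ ∃ α, Satisfies α φ

/-- The search problem `FPAP_Res[b(n)]`. Input: a CNF formula `φ` over `n` variables, a size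
parameter `s ≥ b(n)` in unary (with at least one block) and a Resolution refutation `π` of
`Ref_s(φ)`. Output: a satisfying assignment of `φ`, or `0` if `φ` is unsatisfiable. -/
def FPAPRes (b : ℕ → ℕ) : SearchProblem :=
  {p | ∃ (n : ℕ) (φ : ClauseList (Fin n)) (s : ℕ) (π : ClauseList (RefVar n φ.length s))
      (y : Option (Fin n → Bool)),
    1 ≤ s ∧ b n ≤ s ∧ IsRefutation (Ref s φ.toCNF) (π.map List.toFinset) ∧
      IsCorrectOutput φ.toCNF y ∧ p = (encodeInput n φ s π, encodeOutput y)}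

end ProofAnalysis

/-!
The algorithm treats long and short refutations differently. Let `L` be the number of clauses of the
given refutation `π` of `Ref_s(φ)`.

If `2 ^ n ≤ L + 2 ^ 25`, then all assignments can be tried in polynomial time.

Otherwise `n > 25`, and hence `24 * n * n < s`, and `L < 2 ^ n`. The aim is then to find a satisfying
assignment in any case, so that `φ` is satisfiable. The blocks are divided into the root at level `0`,
the levels `1, …, n` of `24 * n` blocks each, and a rest that is disabled. On this structure a
pretended refutation of `φ` is built, in the shape of a tree: a block at level `k < n` is labelled with
an assignment `u` to the first `k` variables, contains all literals that `u` falsifies, and is resolved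
over the variable with index `k` from two blocks at level `k + 1`, labelled `u0` and `u1`; a block at
level `n` is a weakening of every clause that its label falsifies. The whole tree does not fit into
`s` blocks, but only a small part of it is needed at any time.

* A restriction disables some of the blocks, and sets their other variables such that it satisfies
  all clauses of `π` that mention many blocks of a level. It is found greedily: as long as there are
  such clauses at some level, disabling some block satisfies a twelfth of them. As `L < 2 ^ n`, at most
  `8 * n` blocks of a level are disabled (`isRestriction_greedy`).
* The algorithm walks from the empty clause of `π` back to an axiom, through clauses that are falsified
  by the tree. It remembers the records (label and two premises) of only those blocks which the
  current clause mentions; these are at most `4 * n` at each level, so that there are always two fresh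
  blocks for the next record (`two_le_length_fresh`). At a resolution inference, the block of the
  resolved variable is queried, and one of the premises becomes falsified. Instead of the inferences,
  which are not part of the input, the algorithm tries each clause with each query in turn
  (`walk_spec`).
* The axiom in which the walk ends can only be the one which says that an enabled block without
  premises is a weakening of a clause of `φ`. The label of this block is a total assignment that
  falsifies no clause of `φ` (`exists_satisfies_of_refClause`).

For the running time, `PolyTime f` says that `f` is computed in polynomial time by a structured program
for four stacks of bits, where the data are binary trees in prefix order. This class is closed under
composition, pairing, case distinction, and iteration along a list as long as the state grows by at
most a polynomial amount in each round (`PolyTime.foldl_of_growth`). The algorithm is written with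
these operations, and structured programs are compiled to Turing machines
(`computableInPolyTime_of_run`).
-/

/-! ### Structured stack programs and their translation to Turing machines -/

namespace ProofAnalysis

/-- The four stacks of a stack program: `a` holds the data, `b` and `c` serve as temporary storage,
and `d` holds counters. -/
inductive Stk | a | b | c | d
  deriving DecidableEq

instance : Fintype Stk := ⟨{.a, .b, .c, .d}, fun k => by cases k <;> decide⟩

/-- The contents of the four stacks. -/
abbrev Mem := Stk → List Bool

/-- Structured programs on stacks of bits. -/
inductive Prog : Type
  /-- do nothing -/
  | skip
  /-- push a bit -/
  | push (k : Stk) (v : Bool)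
  /-- run one program after another -/
  | seq (p q : Prog)
  /-- pop a bit and continue according to the outcome: empty stack, `true`, or `false` -/
  | pop (k : Stk) (pn pt pf : Prog)
  /-- pop a bit; if it is `true`, then run the body and repeat, and otherwise stop -/
  | loop (k : Stk) (p : Prog)

open Function in
/-- `Run p S S' t`: the program `p` takes the memory `S` to `S'` in `t` machine steps. -/
inductive Run : Prog → Mem → Mem → ℕ → Prop
  | skip {S} : Run .skip S S 1
  | push {k v S} : Run (.push k v) S (update S k (v :: S k)) 1
  | seq {p q S S' S'' t t'} : Run p S S' t → Run q S' S'' t' → Run (.seq p q) S S'' (t + t')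
  | popNone {k pn pt pf S S' t} : S k = [] → Run pn S S' t → Run (.pop k pn pt pf) S S' (t + 1)
  | popTrue {k pn pt pf S S' t l} : S k = true :: l → Run pt (update S k l) S' t →
      Run (.pop k pn pt pf) S S' (t + 1)
  | popFalse {k pn pt pf S S' t l} : S k = false :: l → Run pf (update S k l) S' t →
      Run (.pop k pn pt pf) S S' (t + 1)
  | loopNone {k p S} : S k = [] → Run (.loop k p) S S 1
  | loopFalse {k p S l} : S k = false :: l → Run (.loop k p) S (update S k l) 1
  | loopTrue {k p S S' S'' t t' l} : S k = true :: l → Run p (update S k l) S' t →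
      Run (.loop k p) S' S'' t' → Run (.loop k p) S S'' (t + t' + 1)

namespace Prog

/-- The positions of a program, which become the labels of a Turing machine. -/
def Label : Prog → Type
  | skip => Unit
  | push _ _ => Unit
  | seq p q => p.Label ⊕ q.Label
  | pop _ pn pt pf => Unit ⊕ pn.Label ⊕ pt.Label ⊕ pf.Label
  | loop _ p => Unit ⊕ p.Label

/-- The position where a program starts. -/
def entry : (p : Prog) → p.Label
  | skip => ()
  | push _ _ => ()
  | seq p _ => .inl p.entry
  | pop _ _ _ _ => .inl ()
  | loop _ _ => .inl ()

theorem finite_label : (p : Prog) → Finite p.Label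
  | skip => inferInstanceAs (Finite Unit)
  | push _ _ => inferInstanceAs (Finite Unit)
  | seq p q =>
    have := p.finite_label
    have := q.finite_label
    inferInstanceAs (Finite (p.Label ⊕ q.Label))
  | pop _ pn pt pf =>
    have := pn.finite_label
    have := pt.finite_label
    have := pf.finite_label
    inferInstanceAs (Finite (Unit ⊕ pn.Label ⊕ pt.Label ⊕ pf.Label))
  | loop _ p =>
    have := p.finite_label
    inferInstanceAs (Finite (Unit ⊕ p.Label))

open Turing.TM2 in
/-- The Turing machine statement at a position of a program that is embedded by `emb` into a larger
program, and continues at `exit`. The internal state of the machine is the last bit popped. -/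
def code {Λ : Type} : (p : Prog) → (p.Label → Λ) → Λ → p.Label →
    Stmt (fun _ : Stk => Bool) Λ (Option Bool)
  | skip, _, exit, _ => .goto fun _ => exit
  | push k v, _, exit, _ => .push k (fun _ => v) (.goto fun _ => exit)
  | seq p q, emb, exit, l =>
    match l with
    | .inl l => p.code (fun l => emb (.inl l)) (emb (.inr q.entry)) l
    | .inr l => q.code (fun l => emb (.inr l)) exit l
  | pop k pn pt pf, emb, exit, l =>
    match l with
    | .inl _ => .pop k (fun _ o => o) (.goto fun o =>
        match o with
        | none => emb (.inr (.inl pn.entry))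
        | some true => emb (.inr (.inr (.inl pt.entry)))
        | some false => emb (.inr (.inr (.inr pf.entry))))
    | .inr (.inl l) => pn.code (fun l => emb (.inr (.inl l))) exit l
    | .inr (.inr (.inl l)) => pt.code (fun l => emb (.inr (.inr (.inl l)))) exit l
    | .inr (.inr (.inr l)) => pf.code (fun l => emb (.inr (.inr (.inr l)))) exit l
  | loop k p, emb, exit, l =>
    match l with
    | .inl _ => .pop k (fun _ o => o) (.goto fun o =>
        match o with
        | some true => emb (.inr p.entry)
        | _ => exit)
    | .inr l => p.code (fun l => emb (.inr l)) (emb (.inl ())) l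

end Prog

section Compile

open Turing Function

/-- `c` reaches `c'` in exactly `t` steps of the machine `M`. -/
def StepsTo {Λ : Type} (M : Λ → TM2.Stmt (fun _ : Stk => Bool) Λ (Option Bool))
    (c c' : TM2.Cfg (fun _ : Stk => Bool) Λ (Option Bool)) (t : ℕ) : Prop :=
  (flip bind (TM2.step M))^[t] (some c) = some c'

variable {Λ : Type} {M : Λ → TM2.Stmt (fun _ : Stk => Bool) Λ (Option Bool)}

theorem StepsTo.trans {c c' c'' : TM2.Cfg (fun _ : Stk => Bool) Λ (Option Bool)} {t t' : ℕ}
    (h : StepsTo M c c' t) (h' : StepsTo M c' c'' t') : StepsTo M c c'' (t + t') := by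
  unfold StepsTo at *
  rw [Nat.add_comm, iterate_add_apply, h, h']

theorem StepsTo.single {l : Λ} {v : Option Bool} {S : Mem}
    {c' : TM2.Cfg (fun _ : Stk => Bool) Λ (Option Bool)}
    (h : TM2.stepAux (M l) v S = c') : StepsTo M ⟨some l, v, S⟩ c' 1 := by
  subst h; rfl

theorem Run.stepsTo {p : Prog} {S S' : Mem} {t : ℕ} (h : Run p S S' t) :
    ∀ (emb : p.Label → Λ) (exit : Λ), (∀ l, M (emb l) = p.code emb exit l) → ∀ v,
      ∃ v', StepsTo M ⟨some (emb p.entry), v, S⟩ ⟨some exit, v', S'⟩ t := by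
  induction h with
  | skip =>
    intro emb exit hM v
    exact ⟨v, .single (by rw [hM]; rfl)⟩
  | push =>
    intro emb exit hM v
    exact ⟨v, .single (by rw [hM]; rfl)⟩
  | seq _ _ ih ih' =>
    intro emb exit hM v
    obtain ⟨v₁, h₁⟩ := ih (fun l => emb (.inl l)) _ (fun l => hM (.inl l)) v
    obtain ⟨v₂, h₂⟩ := ih' (fun l => emb (.inr l)) _ (fun l => hM (.inr l)) v₁
    exact ⟨v₂, h₁.trans h₂⟩
  | @popNone k pn pt pf S S' t hk _ ih =>
    intro emb exit hM v
    obtain ⟨v₁, h₁⟩ := ih (fun l => emb (.inr (.inl l))) exit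
      (fun l => hM (.inr (.inl l))) none
    refine ⟨v₁, Nat.add_comm _ _ ▸ StepsTo.trans (.single ?_) h₁⟩
    rw [hM]
    simp only [Prog.entry, Prog.code, TM2.stepAux, hk, List.head?_nil, List.tail_nil]
    rw [← hk, update_eq_self]
  | @popTrue k pn pt pf S S' t l hk _ ih =>
    intro emb exit hM v
    obtain ⟨v₁, h₁⟩ := ih (fun l => emb (.inr (.inr (.inl l)))) exit
      (fun l => hM (.inr (.inr (.inl l)))) (some true)
    refine ⟨v₁, Nat.add_comm _ _ ▸ StepsTo.trans (.single ?_) h₁⟩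
    rw [hM]
    simp only [Prog.entry, Prog.code, TM2.stepAux, hk, List.head?_cons, List.tail_cons]
  | @popFalse k pn pt pf S S' t l hk _ ih =>
    intro emb exit hM v
    obtain ⟨v₁, h₁⟩ := ih (fun l => emb (.inr (.inr (.inr l)))) exit
      (fun l => hM (.inr (.inr (.inr l)))) (some false)
    refine ⟨v₁, Nat.add_comm _ _ ▸ StepsTo.trans (.single ?_) h₁⟩
    rw [hM]
    simp only [Prog.entry, Prog.code, TM2.stepAux, hk, List.head?_cons, List.tail_cons]
  | loopNone hk =>
    intro emb exit hM v
    refine ⟨none, .single ?_⟩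
    rw [hM]
    simp only [Prog.entry, Prog.code, TM2.stepAux, hk, List.head?_nil, List.tail_nil]
    rw [← hk, update_eq_self]
  | loopFalse hk =>
    intro emb exit hM v
    refine ⟨some false, .single ?_⟩
    rw [hM]
    simp only [Prog.entry, Prog.code, TM2.stepAux, hk, List.head?_cons, List.tail_cons]
  | @loopTrue k p S S' S'' t t' l hk _ _ ih ih' =>
    intro emb exit hM v
    obtain ⟨v₁, h₁⟩ := ih (fun l => emb (.inr l)) (emb (.inl ())) (fun l => hM (.inr l)) (some true)
    obtain ⟨v₂, h₂⟩ := ih' emb exit hM v₁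
    refine ⟨v₂, Nat.add_comm _ _ ▸ StepsTo.trans (.single ?_) (h₁.trans h₂)⟩
    rw [hM]
    simp only [Prog.entry, Prog.code, TM2.stepAux, hk, List.head?_cons, List.tail_cons]

/-- The Turing machine that runs a program. Input and output are on the stack `a`, and the extra
label `none` is the halting routine, which resets the internal state. -/
noncomputable def Prog.machine (p : Prog) : FinTM2 :=
  haveI := p.finite_label
  letI := Fintype.ofFinite p.Label
  { K := Stk
    k₀ := .a
    k₁ := .a
    Γ := fun _ => Bool
    Λ := Option p.Label
    main := some p.entry
    σ := Option Bool
    initialState := none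
    m := fun l =>
      match l with
      | none => .load (fun _ => none) .halt
      | some l => p.code some none l }

/-- The memory with given contents of the four stacks. -/
def mem (a b c d : List Bool) : Mem
  | .a => a
  | .b => b
  | .c => c
  | .d => d

/-- A function is polynomial time computable if some program with a polynomial bound on its running
time computes it, starting and ending with empty auxiliary stacks. -/
theorem computableInPolyTime_of_run {f : List Bool → List Bool} (p : Prog) (T : Polynomial ℕ)
    (h : ∀ x, ∃ t ≤ T.eval x.length, Run p (mem x [] [] []) (mem (f x) [] [] []) t) :
    Nonempty (TM2ComputableInPolyTime (id : List Bool → List Bool) id f) := by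
  have key : ∀ x : List Bool, ∃ t ≤ T.eval x.length + 1,
      (flip bind p.machine.step)^[t] (some (initList p.machine x)) =
        some (haltList p.machine (f x)) := by
    intro x
    obtain ⟨t, ht, hr⟩ := h x
    obtain ⟨v, hv⟩ := hr.stepsTo (M := p.machine.m) (some : p.Label → Option p.Label) none
      (fun l => rfl) none
    have h2 : StepsTo p.machine.m ⟨some none, v, mem (f x) [] [] []⟩
      ⟨none, none, mem (f x) [] [] []⟩ 1 := .single rfl
    refine ⟨t + 1, by omega, ?_⟩
    have h3 := hv.trans h2
    have e1 : initList p.machine x = ⟨some (some p.entry), none, mem x [] [] []⟩ := by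
      unfold initList
      congr 1
      funext k
      cases k <;> rfl
    have e2 : haltList p.machine (f x) = ⟨none, none, mem (f x) [] [] []⟩ := by
      unfold haltList
      congr 1
      funext k
      cases k <;> rfl
    rw [e1, e2]
    exact h3
  choose t ht hrun using key
  exact ⟨{
    tm := p.machine
    inputAlphabet := Equiv.refl Bool
    outputAlphabet := Equiv.refl Bool
    time := T + 1
    outputsFun := fun x =>
      { steps := t x
        evals_in_steps := by
          have := hrun x
          simp only [id]
          erw [List.map_id, List.map_id]
          exact this
        steps_le_m := by simpa using ht x } }⟩

end Compile

end ProofAnalysis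

/-! ### Codes of data and elementary programs on the data stack -/

namespace ProofAnalysis

open Function

/-- Binary trees, the universal data type of the stack programs. -/
inductive BTree
  | leaf
  | node (l r : BTree)

/-- The preorder code of a binary tree, which is self-delimiting. -/
def BTree.bits : BTree → List Bool
  | .leaf => [false]
  | .node l r => true :: (l.bits ++ r.bits)

/-- Types whose elements are represented by binary trees. Nothing is required of the
representation: that it can be used to compute with is a property of particular functions. -/
class Code (α : Type) where
  /-- the tree that represents an element -/
  tree : α → BTree

/-- The bit string that represents an element. -/
def enc {α : Type} [Code α] (x : α) : List Bool := (Code.tree x).bits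

/-- The length of the representation of an element. -/
def size {α : Type} [Code α] (x : α) : ℕ := (enc x).length

/-- `Reach p S S' T`: the program `p` takes the memory `S` to `S'` in at most `T` steps. -/
def Reach (p : Prog) (S S' : Mem) (T : ℕ) : Prop := ∃ t ≤ T, Run p S S' t

@[simp] theorem mem_a (a b c d : List Bool) : mem a b c d .a = a := rfl
@[simp] theorem mem_b (a b c d : List Bool) : mem a b c d .b = b := rfl
@[simp] theorem mem_c (a b c d : List Bool) : mem a b c d .c = c := rfl
@[simp] theorem mem_d (a b c d : List Bool) : mem a b c d .d = d := rfl

@[simp] theorem update_mem_a (a b c d x : List Bool) :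
    update (mem a b c d) .a x = mem x b c d := by
  funext k; cases k <;> rfl

@[simp] theorem update_mem_b (a b c d x : List Bool) :
    update (mem a b c d) .b x = mem a x c d := by
  funext k; cases k <;> rfl

@[simp] theorem update_mem_c (a b c d x : List Bool) :
    update (mem a b c d) .c x = mem a b x d := by
  funext k; cases k <;> rfl

@[simp] theorem update_mem_d (a b c d x : List Bool) :
    update (mem a b c d) .d x = mem a b c x := by
  funext k; cases k <;> rfl

namespace Reach

theorem mono {p : Prog} {S S' : Mem} {T T' : ℕ} (h : Reach p S S' T) (hT : T ≤ T') :
    Reach p S S' T' :=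
  let ⟨t, ht, hr⟩ := h
  ⟨t, ht.trans hT, hr⟩

theorem skip {S : Mem} : Reach .skip S S 1 := ⟨1, le_rfl, .skip⟩

theorem push {k : Stk} {v : Bool} {S : Mem} : Reach (.push k v) S (update S k (v :: S k)) 1 :=
  ⟨1, le_rfl, .push⟩

theorem push_a {v : Bool} {a b c d : List Bool} :
    Reach (.push .a v) (mem a b c d) (mem (v :: a) b c d) 1 := by
  simpa using push (k := .a) (v := v) (S := mem a b c d)

theorem push_b {v : Bool} {a b c d : List Bool} :
    Reach (.push .b v) (mem a b c d) (mem a (v :: b) c d) 1 := by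
  simpa using push (k := .b) (v := v) (S := mem a b c d)

theorem push_c {v : Bool} {a b c d : List Bool} :
    Reach (.push .c v) (mem a b c d) (mem a b (v :: c) d) 1 := by
  simpa using push (k := .c) (v := v) (S := mem a b c d)

theorem push_d {v : Bool} {a b c d : List Bool} :
    Reach (.push .d v) (mem a b c d) (mem a b c (v :: d)) 1 := by
  simpa using push (k := .d) (v := v) (S := mem a b c d)

theorem seq {p q : Prog} {S S' S'' : Mem} {T T' : ℕ} (h : Reach p S S' T) (h' : Reach q S' S'' T') :
    Reach (.seq p q) S S'' (T + T') :=
  let ⟨_, ht, hr⟩ := h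
  let ⟨_, ht', hr'⟩ := h'
  ⟨_, Nat.add_le_add ht ht', hr.seq hr'⟩

variable {k : Stk} {pn pt pf p : Prog} {S S' S'' : Mem} {T T' : ℕ} {l : List Bool}

theorem popNone (hk : S k = []) (h : Reach pn S S' T) : Reach (.pop k pn pt pf) S S' (T + 1) :=
  let ⟨_, ht, hr⟩ := h
  ⟨_, Nat.add_le_add_right ht 1, hr.popNone hk⟩

theorem popTrue (hk : S k = true :: l) (h : Reach pt (update S k l) S' T) :
    Reach (.pop k pn pt pf) S S' (T + 1) :=
  let ⟨_, ht, hr⟩ := h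
  ⟨_, Nat.add_le_add_right ht 1, hr.popTrue hk⟩

theorem popFalse (hk : S k = false :: l) (h : Reach pf (update S k l) S' T) :
    Reach (.pop k pn pt pf) S S' (T + 1) :=
  let ⟨_, ht, hr⟩ := h
  ⟨_, Nat.add_le_add_right ht 1, hr.popFalse hk⟩

theorem loopNone (hk : S k = []) : Reach (.loop k p) S S 1 := ⟨1, le_rfl, .loopNone hk⟩

theorem loopFalse (hk : S k = false :: l) : Reach (.loop k p) S (update S k l) 1 :=
  ⟨1, le_rfl, .loopFalse hk⟩

theorem loopTrue (hk : S k = true :: l) (h : Reach p (update S k l) S' T)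
    (h' : Reach (.loop k p) S' S'' T') : Reach (.loop k p) S S'' (T + T' + 1) :=
  let ⟨_, ht, hr⟩ := h
  let ⟨_, ht', hr'⟩ := h'
  ⟨_, Nat.add_le_add_right (Nat.add_le_add ht ht') 1, hr.loopTrue hk hr'⟩

end Reach

/-- A stack grows by at most one bit per step. -/
theorem Run.length_le {p : Prog} {S S' : Mem} {t : ℕ} (h : Run p S S' t) (j : Stk) :
    (S' j).length ≤ (S j).length + t := by
  induction h with
  | skip => omega
  | @push k v S =>
    by_cases hj : j = k
    · subst hj; simp
    · simp [update_of_ne hj]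
  | seq _ _ ih ih' => omega
  | popNone _ _ ih => omega
  | @popTrue k _ _ _ S S' t l hk _ ih | @popFalse k _ _ _ S S' t l hk _ ih =>
    refine ih.trans ?_
    by_cases hj : j = k
    · subst hj; simp [hk]; omega
    · simp [update_of_ne hj]
  | loopNone => omega
  | @loopFalse k p S l hk =>
    by_cases hj : j = k
    · subst hj; simp [hk]; omega
    · simp [update_of_ne hj]
  | @loopTrue k p S S' S'' t t' l hk _ _ ih ih' =>
    have : (update S k l j).length ≤ (S j).length := by
      by_cases hj : j = k
      · subst hj; simp [hk]
      · simp [update_of_ne hj]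
    omega

/-- Bits as they are kept on a storage stack: each is preceded by `true`, so that a `false` in front
marks the end. -/
def flagged : List Bool → List Bool
  | [] => []
  | v :: l => true :: v :: flagged l

theorem flagged_append (l l' : List Bool) : flagged (l ++ l') = flagged l ++ flagged l' := by
  induction l with
  | nil => rfl
  | cons v l ih => simp [flagged, ih]

/-- The storage stack `b` after the bits `l` have been moved there, if `sel` says so. -/
def stored (sel : Bool) (l b : List Bool) : List Bool :=
  bif sel then flagged l.reverse ++ b else b

theorem stored_append (sel : Bool) (l l' b : List Bool) :
    stored sel (l ++ l') b = stored sel l' (stored sel l b) := by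
  cases sel <;> simp [stored, flagged_append]

namespace Prog

/-- Move one bit to the storage stacks selected by `f` and `g`. -/
def store (f g v : Bool) : Prog :=
  .seq (bif f then .seq (.push .b v) (.push .b true) else .skip)
    (bif g then .seq (.push .c v) (.push .c true) else .skip)

/-- The main loop of `move`; the number of trees still to be moved is kept in unary on `d`. -/
def moveLoop (f g : Bool) : Prog :=
  .loop .d (.pop .a .skip
    (.seq (store f g true) (.seq (.push .d true) (.push .d true)))
    (store f g false))

/-- Move the topmost tree of the data stack to the storage stacks selected by `f` and `g`. -/
def move (f g : Bool) : Prog :=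
  .seq (bif f then .push .b false else .skip) <|
  .seq (bif g then .push .c false else .skip) <|
  .seq (.push .d false) <| .seq (.push .d true) <| moveLoop f g

/-- Move the topmost item of the storage stack `k` back to the data stack. -/
def back (k : Stk) : Prog :=
  .loop k (.pop k .skip (.push .a true) (.push .a false))

/-- Remove the topmost tree. -/
def drop : Prog := move false false

/-- Duplicate the topmost tree. -/
def dup : Prog := .seq (move true true) (.seq (back .b) (back .c))

/-- Exchange the two topmost trees. -/
def swap : Prog :=
  .seq (move true false) (.seq (move false true) (.seq (back .b) (back .c)))

/-- Run a program below the topmost tree. -/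
def dip (p : Prog) : Prog := .seq (move true false) (.seq p (back .b))

/-- Push a list of bits, the last one first. -/
def pushAll : List Bool → Prog
  | [] => .skip
  | v :: l => .seq (pushAll l) (.push .a v)

end Prog

theorem reach_store (f g v : Bool) (a b c d : List Bool) :
    Reach (Prog.store f g v) (mem a b c d) (mem a (stored f [v] b) (stored g [v] c) d) 4 := by
  have h1 : Reach (bif f then Prog.seq (.push .b v) (.push .b true) else .skip) (mem a b c d)
      (mem a (stored f [v] b) c d) 2 := by
    cases f
    · exact Reach.skip.mono (by omega)
    · exact Reach.push_b.seq Reach.push_b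
  have h2 (b : List Bool) : Reach (bif g then Prog.seq (.push .c v) (.push .c true) else .skip)
      (mem a b c d) (mem a b (stored g [v] c) d) 2 := by
    cases g
    · exact Reach.skip.mono (by omega)
    · exact Reach.push_c.seq Reach.push_c
  exact h1.seq (h2 _)

theorem reach_moveLoop (f g : Bool) (t : BTree) : ∀ (R b c d : List Bool) (S : Mem) (T : ℕ),
    Reach (Prog.moveLoop f g) (mem R (stored f t.bits b) (stored g t.bits c) d) S T →
    Reach (Prog.moveLoop f g) (mem (t.bits ++ R) b c (true :: d)) S (T + 10 * t.bits.length) := by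
  induction t with
  | leaf =>
    intro R b c d S T h
    refine (Reach.loopTrue (S := mem _ b c (true :: d)) (l := d) rfl ?_ h).mono
      (show 5 + T + 1 ≤ _ by simp [BTree.bits]; omega)
    simp only [update_mem_d]
    refine Reach.popFalse (l := R) (T := 4) rfl ?_
    simp only [update_mem_a]
    exact reach_store ..
  | node l r ihl ihr =>
    intro R b c d S T h
    have e (sel : Bool) (b : List Bool) : stored sel (BTree.node l r).bits b =
        stored sel r.bits (stored sel l.bits (stored sel [true] b)) := by
      rw [← stored_append, ← stored_append]; rfl
    rw [e, e] at h
    have h2 := ihl _ _ _ _ _ _ (ihr _ _ _ _ _ _ h)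
    refine (Reach.loopTrue (S := mem _ b c (true :: d)) (l := d) (T := 7) rfl ?_ h2).mono
      (by simp [BTree.bits]; omega)
    simp only [update_mem_d]
    refine Reach.popTrue (l := l.bits ++ (r.bits ++ R)) (T := 6) (by simp [BTree.bits]) ?_
    simp only [update_mem_a]
    exact (reach_store ..).seq (Reach.push_d.seq Reach.push_d)

theorem reach_move (f g : Bool) (t : BTree) (R b c d : List Bool) :
    Reach (Prog.move f g) (mem (t.bits ++ R) b c d)
      (mem R (bif f then flagged t.bits.reverse ++ false :: b else b)
        (bif g then flagged t.bits.reverse ++ false :: c else c) d) (10 * t.bits.length + 5) := by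
  have h1 : Reach (bif f then Prog.push .b false else .skip) (mem (t.bits ++ R) b c d)
      (mem (t.bits ++ R) (bif f then false :: b else b) c d) 1 := by
    cases f
    · exact Reach.skip
    · exact Reach.push_b
  have h2 (b : List Bool) : Reach (bif g then Prog.push .c false else .skip)
      (mem (t.bits ++ R) b c d) (mem (t.bits ++ R) b (bif g then false :: c else c) d) 1 := by
    cases g
    · exact Reach.skip
    · exact Reach.push_c
  have h3 (b c : List Bool) := reach_moveLoop f g t R b c (false :: d) _ _
    (Reach.loopFalse (S := mem R _ _ (false :: d)) rfl)
  simp only [update_mem_d] at h3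
  have h := h1.seq ((h2 _).seq (Reach.push_d.seq (Reach.push_d.seq (h3 _ _))))
  have e : ∀ (sel : Bool) (b : List Bool), stored sel t.bits (bif sel then false :: b else b) =
      bif sel then flagged t.bits.reverse ++ false :: b else b := by
    intro sel b; cases sel <;> rfl
  rw [e, e] at h
  exact h.mono (by omega)

theorem reach_back_b (l : List Bool) : ∀ a b c d,
    Reach (Prog.back .b) (mem a (flagged l ++ false :: b) c d) (mem (l.reverse ++ a) b c d)
      (3 * l.length + 1) := by
  induction l with
  | nil =>
    intro a b c d
    have h := Reach.loopFalse (k := .b) (S := mem a (false :: b) c d) (l := b)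
      (p := .pop .b .skip (.push .a true) (.push .a false)) rfl
    rwa [update_mem_b] at h
  | cons v l ih =>
    intro a b c d
    rw [List.reverse_cons, List.append_assoc]
    refine (Reach.loopTrue (S := mem _ _ c d) (l := v :: (flagged l ++ false :: b)) (T := 2)
      rfl ?_ (ih (v :: a) b c d)).mono (by simp; omega)
    simp only [update_mem_b]
    cases v
    · refine Reach.popFalse (T := 1) rfl ?_
      simp only [update_mem_b]
      exact Reach.push_a
    · refine Reach.popTrue (T := 1) rfl ?_
      simp only [update_mem_b]
      exact Reach.push_a

theorem reach_back_c (l : List Bool) : ∀ a b c d,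
    Reach (Prog.back .c) (mem a b (flagged l ++ false :: c) d) (mem (l.reverse ++ a) b c d)
      (3 * l.length + 1) := by
  induction l with
  | nil =>
    intro a b c d
    have h := Reach.loopFalse (k := .c) (S := mem a b (false :: c) d) (l := c)
      (p := .pop .c .skip (.push .a true) (.push .a false)) rfl
    rwa [update_mem_c] at h
  | cons v l ih =>
    intro a b c d
    rw [List.reverse_cons, List.append_assoc]
    refine (Reach.loopTrue (S := mem _ b _ d) (l := v :: (flagged l ++ false :: c)) (T := 2)
      rfl ?_ (ih (v :: a) b c d)).mono (by simp; omega)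
    simp only [update_mem_c]
    cases v
    · refine Reach.popFalse (T := 1) rfl ?_
      simp only [update_mem_c]
      exact Reach.push_a
    · refine Reach.popTrue (T := 1) rfl ?_
      simp only [update_mem_c]
      exact Reach.push_a

/-- `Does p u v T`: in at most `T` steps, the program `p` replaces `u` at the top of the data stack
by `v`, and leaves everything else unchanged. -/
def Does (p : Prog) (u v : List Bool) (T : ℕ) : Prop :=
  ∀ R b c d, Reach p (mem (u ++ R) b c d) (mem (v ++ R) b c d) T

namespace Does

variable {p q : Prog} {u v w : List Bool} {T T' : ℕ}

theorem mono (h : Does p u v T) (hT : T ≤ T') : Does p u v T' :=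
  fun R b c d => (h R b c d).mono hT

theorem skip : Does .skip u u 1 := fun _ _ _ _ => Reach.skip

theorem seq (h : Does p u v T) (h' : Does q v w T') : Does (.seq p q) u w (T + T') :=
  fun R b c d => (h R b c d).seq (h' R b c d)

theorem frame (w : List Bool) (h : Does p u v T) : Does p (u ++ w) (v ++ w) T := by
  intro R b c d
  simpa using h (w ++ R) b c d

theorem push (x : Bool) : Does (.push .a x) u (x :: u) 1 := fun _ _ _ _ => Reach.push_a

theorem pushAll (l : List Bool) : Does (Prog.pushAll l) [] l (l.length + 1) := by
  induction l with
  | nil => exact skip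
  | cons x l ih => exact ih.seq (push x)

theorem popTrue {pn pf : Prog} (h : Does p u v T) : Does (.pop .a pn p pf) (true :: u) v (T + 1) :=
  fun R b c d => Reach.popTrue (l := u ++ R) rfl (by simpa using h R b c d)

theorem popFalse {pn pt : Prog} (h : Does p u v T) :
    Does (.pop .a pn pt p) (false :: u) v (T + 1) :=
  fun R b c d => Reach.popFalse (l := u ++ R) rfl (by simpa using h R b c d)

section

variable {α β : Type} [Code α] [Code β] (x : α) (y : β)

theorem drop : Does Prog.drop (enc x) [] (10 * size x + 5) :=
  fun R b c d => reach_move false false (Code.tree x) R b c d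

theorem dup : Does Prog.dup (enc x) (enc x ++ enc x) (20 * size x + 10) := by
  intro R b c d
  have h1 := reach_move true true (Code.tree x) R b c d
  have h2 := reach_back_b (enc x).reverse R b (flagged (enc x).reverse ++ false :: c) d
  have h3 := reach_back_c (enc x).reverse (enc x ++ R) b c d
  simp only [List.reverse_reverse, List.length_reverse] at h2 h3
  simp only [List.append_assoc]
  exact (h1.seq (h2.seq h3)).mono (show _ ≤ 20 * size x + 10 by
    change 10 * size x + 5 + (3 * size x + 1 + (3 * size x + 1)) ≤ _; omega)

theorem swap : Does Prog.swap (enc x ++ enc y) (enc y ++ enc x) (20 * (size x + size y) + 15) := by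
  intro R b c d
  have h1 := reach_move true false (Code.tree x) (enc y ++ R) b c d
  have h2 := reach_move false true (Code.tree y) R (flagged (enc x).reverse ++ false :: b) c d
  have h3 := reach_back_b (enc x).reverse R b (flagged (enc y).reverse ++ false :: c) d
  have h4 := reach_back_c (enc y).reverse (enc x ++ R) b c d
  simp only [List.reverse_reverse, List.length_reverse] at h3 h4
  simp only [List.append_assoc]
  exact (h1.seq (h2.seq (h3.seq h4))).mono (show _ ≤ 20 * (size x + size y) + 15 by
    change 10 * size x + 5 + (10 * size y + 5 + (3 * size x + 1 + (3 * size y + 1))) ≤ _; omega)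

theorem dip (h : Does p u v T) :
    Does (Prog.dip p) (enc x ++ u) (enc x ++ v) (T + 20 * size x + 10) := by
  intro R b c d
  have h1 := reach_move true false (Code.tree x) (u ++ R) b c d
  have h2 := h R (flagged (enc x).reverse ++ false :: b) c d
  have h3 := reach_back_b (enc x).reverse (v ++ R) b c d
  simp only [List.reverse_reverse, List.length_reverse] at h3
  simp only [List.append_assoc]
  exact (h1.seq (h2.seq h3)).mono (show _ ≤ T + 20 * size x + 10 by
    change 10 * size x + 5 + (T + (3 * size x + 1)) ≤ _; omega)

end

end Does

theorem Does.length_le {p : Prog} {u v : List Bool} {T : ℕ} (h : Does p u v T) :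
    v.length ≤ u.length + T := by
  obtain ⟨t, ht, hr⟩ := h [] [] [] []
  have := hr.length_le .a
  simp at this
  omega

/-! ### Data types -/

instance : Code Unit := ⟨fun _ => .leaf⟩

instance {α β : Type} [Code α] [Code β] : Code (α × β) := ⟨fun p => .node (Code.tree p.1) (Code.tree p.2)⟩

/-- The tree of a list. -/
def listTree {α : Type} [Code α] : List α → BTree
  | [] => .leaf
  | a :: l => .node (Code.tree a) (listTree l)

instance {α : Type} [Code α] : Code (List α) := ⟨listTree⟩

/-- Numbers are represented in unary. -/
instance : Code ℕ := ⟨fun n => listTree (List.replicate n ())⟩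

instance : Code Bool := ⟨fun b => bif b then .node .leaf .leaf else .leaf⟩

instance {α : Type} [Code α] : Code (Option α) := ⟨fun o => listTree o.toList⟩

section

variable {α β : Type} [Code α] [Code β]

theorem enc_prod (x : α) (y : β) : enc (x, y) = true :: (enc x ++ enc y) := rfl

theorem enc_cons (a : α) (l : List α) : enc (a :: l) = true :: (enc a ++ enc l) := rfl

@[simp] theorem size_prod (x : α) (y : β) : size (x, y) = size x + size y + 1 := by
  simp [size, enc_prod]

@[simp] theorem size_nil : size ([] : List α) = 1 := rfl

@[simp] theorem size_cons (a : α) (l : List α) : size (a :: l) = size a + size l + 1 := by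
  simp [size, enc_cons]

@[simp] theorem size_unit (x : Unit) : size x = 1 := rfl

theorem size_bool_le (b : Bool) : size b ≤ 3 := by cases b <;> decide

@[simp] theorem size_nat (n : ℕ) : size n = 2 * n + 1 := by
  change size (List.replicate n ()) = _
  induction n with
  | zero => rfl
  | succ n ih => rw [List.replicate_succ, size_cons, ih, size_unit]; omega

theorem length_lt_size (l : List α) : l.length < size l := by
  induction l with
  | nil => simp
  | cons a l ih => simp; omega

theorem size_append (l l' : List α) : size (l ++ l') + 1 = size l + size l' := by
  induction l with
  | nil => simp; omega
  | cons a l ih => simp; omega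

theorem size_le_of_mem {a : α} {l : List α} (h : a ∈ l) : size a ≤ size l := by
  induction h with
  | head => simp; omega
  | tail _ _ ih => simp; omega

theorem size_le_of_sublist {l l' : List α} (h : l.Sublist l') : size l ≤ size l' := by
  induction h with
  | slnil => rfl
  | cons _ _ ih => simp; omega
  | cons_cons _ _ ih => simp; omega

theorem size_list_le {l : List α} {N : ℕ} (h : ∀ a ∈ l, size a ≤ N) :
    size l ≤ l.length * (N + 1) + 1 := by
  induction l with
  | nil => simp
  | cons a l ih =>
    have h1 := h a (by simp)
    have h2 := ih fun a ha => h a (by simp [ha])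
    simp only [size_cons, List.length_cons, Nat.add_mul, Nat.one_mul]
    omega

end

end ProofAnalysis

/-! ### Polynomial time functions between coded types -/

namespace ProofAnalysis

open Polynomial in
theorem eval_mono (T : Polynomial ℕ) {m n : ℕ} (h : m ≤ n) : T.eval m ≤ T.eval n := by
  rw [Polynomial.eval_eq_sum, Polynomial.eval_eq_sum]
  exact Finset.sum_le_sum fun i _ => Nat.mul_le_mul_left _ (Nat.pow_le_pow_left h i)

/-- A function between coded types is computable in polynomial time if some stack program replaces
(the code of) an argument on top of the data stack by the value, in time polynomial in the size of
the argument. -/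
@[fun_prop]
def PolyTime {α β : Type} [Code α] [Code β] (f : α → β) : Prop :=
  ∃ (p : Prog) (T : Polynomial ℕ), ∀ x, Does p (enc x) (enc (f x)) (T.eval (size x))

namespace PolyTime

variable {α β γ δ σ : Type} [Code α] [Code β] [Code γ] [Code δ] [Code σ]

theorem size_le {f : α → β} (hf : PolyTime f) :
    ∃ Q : Polynomial ℕ, ∀ x, size (f x) ≤ Q.eval (size x) := by
  obtain ⟨p, T, h⟩ := hf
  refine ⟨Polynomial.X + T, fun x => ?_⟩
  rw [Polynomial.eval_add, Polynomial.eval_X]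
  exact (h x).length_le

/-- A function that does not change the code is computed by the empty program. -/
theorem of_enc_eq {f : α → β} (h : ∀ x, enc (f x) = enc x) : PolyTime f :=
  ⟨.skip, 1, fun x => by rw [h]; exact Does.skip.mono (by simp)⟩

@[fun_prop]
theorem id' : PolyTime fun x : α => x := of_enc_eq fun _ => rfl

@[fun_prop]
theorem comp {f : β → γ} {g : α → β} (hf : PolyTime f) (hg : PolyTime g) :
    PolyTime fun x => f (g x) := by
  obtain ⟨Q, hQ⟩ := hg.size_le
  obtain ⟨p, T, hp⟩ := hf
  obtain ⟨q, U, hq⟩ := hg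
  refine ⟨.seq q p, U + T.comp Q, fun x => ((hq x).seq (hp (g x))).mono ?_⟩
  rw [Polynomial.eval_add, Polynomial.eval_comp]
  exact Nat.add_le_add_left (eval_mono T (hQ x)) _

@[fun_prop]
theorem const (y : β) : PolyTime fun _ : α => y := by
  refine ⟨.seq .drop (.pushAll (enc y)), 10 * Polynomial.X + 6 + .C (size y), fun x => ?_⟩
  refine ((Does.drop x).seq (Does.pushAll _)).mono ?_
  simp [size]
  omega

@[fun_prop]
theorem fst : PolyTime (Prod.fst : α × β → α) := by
  refine ⟨.pop .a .skip (.seq .swap .drop) .skip, 60 * Polynomial.X + 60, fun ⟨x, y⟩ => ?_⟩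
  rw [enc_prod]
  have h := (Does.drop y).frame (enc x)
  refine (((Does.swap x y).seq h).popTrue).mono ?_
  simp
  omega

@[fun_prop]
theorem snd : PolyTime (Prod.snd : α × β → β) := by
  refine ⟨.pop .a .skip .drop .skip, 60 * Polynomial.X + 60, fun ⟨x, y⟩ => ?_⟩
  rw [enc_prod]
  refine (((Does.drop x).frame (enc y)).popTrue).mono ?_
  simp
  omega

@[fun_prop]
theorem prodMk {f : α → β} {g : α → γ} (hf : PolyTime f) (hg : PolyTime g) :
    PolyTime fun x => (f x, g x) := by
  obtain ⟨Q, hQ⟩ := hf.size_le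
  obtain ⟨P, hP⟩ := hg.size_le
  obtain ⟨p, T, hp⟩ := hf
  obtain ⟨q, U, hq⟩ := hg
  refine ⟨.seq .dup (.seq p (.seq .swap (.seq q (.seq .swap (.push .a true))))),
    40 * Polynomial.X + 50 + T + U + 40 * Q + 40 * P, fun x => ?_⟩
  refine ((Does.dup x).seq (((hp x).frame (enc x)).seq ((Does.swap (f x) x).seq
    (((hq x).frame (enc (f x))).seq ((Does.swap (g x) (f x)).seq (Does.push true)))))).mono ?_
  have h1 := hQ x
  have h2 := hP x
  simp
  omega

/-- Case distinction on a list. -/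
theorem listCases {l : α → List β} {f : α → γ} {g : α → β → List β → γ} (hl : PolyTime l)
    (hf : PolyTime f) (hg : PolyTime fun q : α × β × List β => g q.1 q.2.1 q.2.2) :
    PolyTime fun x => match l x with
      | [] => f x
      | b :: t => g x b t := by
  obtain ⟨Q, hQ⟩ := hl.size_le
  obtain ⟨p, T, hp⟩ := hl
  obtain ⟨q, U, hq⟩ := hf
  obtain ⟨r, W, hr⟩ := hg
  refine ⟨.seq .dup (.seq p (.pop .a .skip
      (.seq (.push .a true) (.seq .swap (.seq (.push .a true) r))) q)),
    40 * Polynomial.X + 50 + T + U + 40 * Q + W.comp (Polynomial.X + Q + 1), fun x => ?_⟩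
  have h1 := hQ x
  dsimp only
  cases hx : l x with
  | nil =>
    have h3 := (hq x).popFalse (pn := .skip)
      (pt := .seq (.push .a true) (.seq .swap (.seq (.push .a true) r)))
    refine (((Does.dup x).seq ((((hx ▸ hp x : Does p (enc x) (enc ([] : List β)) _)).frame
      (enc x)).seq h3))).mono ?_
    simp
    omega
  | cons y t =>
    rw [hx] at h1
    have h3 := ((Does.push true (u := enc y ++ enc t)).frame (enc x)).seq
      ((Does.swap (y, t) x).seq ((Does.push true).seq (hr (x, y, t))))
    have h4 := h3.popTrue (pn := .skip) (pf := q)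
    have h5 : Does p (enc x) (true :: (enc y ++ enc t)) (T.eval (size x)) := by
      rw [← enc_cons, ← hx]; exact hp x
    refine ((Does.dup x).seq ((h5.frame (enc x)).seq h4)).mono ?_
    have h6 : W.eval (size (x, y, t)) ≤ W.eval (size x + Q.eval (size x) + 1) := by
      apply eval_mono; simp at h1 ⊢; omega
    simp at h1 h6 ⊢
    omega

/-- The loop that folds the program `p` along a list; each round has the topmost entry of the list,
its tail, the parameter and the current value on the data stack. -/
def foldlLoop (p : Prog) : Prog :=
  .loop .a (.seq .swap (.dip (.seq .swap (.seq .dup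
    (.dip (.seq (.dip (.seq .swap (.push .a true))) (.seq (.push .a true) p)))))))

theorem reach_foldl {step : γ → σ → α → σ} {p : Prog} {T : Polynomial ℕ}
    (hp : ∀ q : γ × σ × α, Does p (enc q) (enc (step q.1 q.2.1 q.2.2)) (T.eval (size q)))
    (x : γ) (Z : ℕ) (hx : size x ≤ Z) (l : List α) : ∀ s : σ, size l ≤ Z →
    (∀ l', l' <+: l → size (l'.foldl (step x) s) ≤ Z) →
    Does (foldlLoop p)
      (enc l ++ (enc x ++ enc s)) (enc x ++ enc (l.foldl (step x) s))
      (l.length * (200 * Z + 200 + T.eval (3 * Z + 2)) + 1) := by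
  induction l with
  | nil =>
    intro s _ _ R b c d
    have h := Reach.loopFalse (S := mem (enc ([] : List α) ++ (enc x ++ enc s) ++ R) b c d)
      (k := .a) (p := .seq .swap (.dip (.seq .swap (.seq .dup
        (.dip (.seq (.dip (.seq .swap (.push .a true))) (.seq (.push .a true) p)))))))
      (l := enc x ++ enc s ++ R) rfl
    rw [update_mem_a] at h
    exact h.mono (by simp)
  | cons a l ih =>
    intro s hl hs R b c d
    have hs0 : size s ≤ Z := hs [] (List.nil_prefix)
    simp only [size_cons] at hl
    have ih' := ih (step x s a) (by omega) (fun l' hl' => by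
      simpa using hs (a :: l') (List.cons_prefix_cons.2 ⟨rfl, hl'⟩))
    have k1 : Does (.seq (.dip (.seq .swap (.push .a true))) (.seq (.push .a true) p))
        (enc x ++ (enc a ++ enc s)) (enc (step x s a)) _ :=
      (Does.dip x ((Does.swap a s).seq (Does.push true))).seq
        ((Does.push true).seq (hp (x, s, a)))
    have k2 := (Does.swap a x).frame (enc s)
    have k3 := (Does.dup x).frame (enc a ++ enc s)
    simp only [List.append_assoc] at k2 k3
    have k4 := Does.dip l (k2.seq (k3.seq (Does.dip x k1)))
    have k5 := (Does.swap a l).frame (enc x ++ enc s)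
    rw [List.append_assoc, List.append_assoc] at k5
    have k6 := k5.seq k4
    have hT : T.eval (size (x, s, a)) ≤ T.eval (3 * Z + 2) := by
      apply eval_mono; simp; omega
    refine (Reach.loopTrue (k := .a) (S := mem (enc (a :: l) ++ (enc x ++ enc s) ++ R) b c d)
      (l := enc a ++ (enc l ++ (enc x ++ enc s)) ++ R) (T := 200 * Z + 199 + T.eval (3 * Z + 2))
      ?_ ?_ (ih' R b c d)).mono ?_
    · simp [enc_cons]
    · rw [update_mem_a]
      refine (k6 R b c d).mono ?_
      omega
    · simp only [List.length_cons, Nat.add_mul]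
      omega

/-- Iteration along a list, with a polynomial bound on the size of all intermediate results. -/
theorem foldl {l : γ → List α} {s₀ : γ → σ} {step : γ → σ → α → σ} (hl : PolyTime l)
    (hs : PolyTime s₀) (hstep : PolyTime fun q : γ × σ × α => step q.1 q.2.1 q.2.2)
    (hQ : ∃ Q : Polynomial ℕ, ∀ x l', l' <+: l x →
      size (l'.foldl (step x) (s₀ x)) ≤ Q.eval (size x)) :
    PolyTime fun x => (l x).foldl (step x) (s₀ x) := by
  obtain ⟨Q, hQ⟩ := hQ
  obtain ⟨P, hP⟩ := hl.size_le
  obtain ⟨q, U, hq⟩ := hs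
  obtain ⟨r, W, hr⟩ := hl
  obtain ⟨p, T, hp⟩ := hstep
  let Z : Polynomial ℕ := Polynomial.X + Q + P
  refine ⟨.seq .dup (.seq q (.seq .swap (.seq .dup (.seq r (.seq (foldlLoop p) .drop))))),
    100 * Z + 100 + U + W + Z * (200 * Z + 200 + T.comp (3 * Z + 2)), fun x => ?_⟩
  have hx : size x ≤ Z.eval (size x) := by simp [Z]; omega
  have hl : size (l x) ≤ Z.eval (size x) := (hP x).trans (by simp [Z])
  have hs' : ∀ l', l' <+: l x → size (l'.foldl (step x) (s₀ x)) ≤ Z.eval (size x) :=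
    fun l' hl' => (hQ x l' hl').trans (by simp [Z]; omega)
  have k := reach_foldl hp x _ hx (l x) (s₀ x) hl hs'
  have h0 : size (s₀ x) ≤ Z.eval (size x) := hs' [] List.nil_prefix
  have hlen := (length_lt_size (l x)).le.trans hl
  have k1 := (Does.dup x).frame (enc (s₀ x))
  have k2 := (hr x).frame (enc x ++ enc (s₀ x))
  rw [List.append_assoc] at k1
  have k3 := (Does.dup x).seq (((hq x).frame (enc x)).seq ((Does.swap (s₀ x) x).seq
    (k1.seq (k2.seq (k.seq ((Does.drop x).frame _))))))
  refine k3.mono ?_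
  have h2 := Nat.mul_le_mul_right (200 * Z.eval (size x) + 200 + T.eval (3 * Z.eval (size x) + 2))
    hlen
  simp only [Polynomial.eval_add, Polynomial.eval_mul, Polynomial.eval_comp,
    Polynomial.eval_ofNat]
  omega

/-- Iteration along a list, where each round adds a polynomial amount to the size. -/
theorem foldl_of_growth {l : γ → List α} {s₀ : γ → σ} {step : γ → σ → α → σ} (hl : PolyTime l)
    (hs : PolyTime s₀) (hstep : PolyTime fun q : γ × σ × α => step q.1 q.2.1 q.2.2)
    (hQ : ∃ Q : Polynomial ℕ, ∀ x s a, size (step x s a) ≤ size s + Q.eval (size x + size a)) :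
    PolyTime fun x => (l x).foldl (step x) (s₀ x) := by
  refine foldl hl hs hstep ?_
  obtain ⟨Q, hQ⟩ := hQ
  obtain ⟨P, hP⟩ := hl.size_le
  obtain ⟨U, hU⟩ := hs.size_le
  refine ⟨U + P * Q.comp (Polynomial.X + P), fun x l' hl' => ?_⟩
  have key : ∀ (l₁ : List α), (∀ a ∈ l₁, size a ≤ P.eval (size x)) → ∀ s,
      size (l₁.foldl (step x) s) ≤ size s + l₁.length * Q.eval (size x + P.eval (size x)) := by
    intro l₁
    induction l₁ with
    | nil => simp
    | cons a l₁ ih =>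
      intro h s
      have h1 := ih (fun a ha => h a (by simp [ha])) (step x s a)
      have h2 := hQ x s a
      have h3 := eval_mono Q (Nat.add_le_add_left (h a (by simp)) (size x))
      simp only [List.foldl_cons, List.length_cons, Nat.add_mul]
      omega
  have h1 := key l' (fun a ha => (size_le_of_mem (hl'.subset ha)).trans (hP x)) (s₀ x)
  have h2 : l'.length ≤ P.eval (size x) :=
    hl'.length_le.trans ((length_lt_size _).le.trans (hP x))
  have h3 := Nat.mul_le_mul_right (Q.eval (size x + P.eval (size x))) h2
  have h4 := hU x
  simp only [Polynomial.eval_add, Polynomial.eval_mul, Polynomial.eval_comp, Polynomial.eval_X]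
  omega

end PolyTime

end ProofAnalysis

/-! ### Basic polynomial time functions -/

namespace ProofAnalysis

namespace PolyTime

variable {α β γ δ σ : Type} [Code α] [Code β] [Code γ] [Code δ] [Code σ]

section Lists

theorem uncurried_cons : PolyTime fun q : α × List α => q.1 :: q.2 := of_enc_eq fun _ => rfl

@[fun_prop]
theorem cons {a : γ → α} {l : γ → List α} (ha : PolyTime a) (hl : PolyTime l) :
    PolyTime fun x => a x :: l x :=
  uncurried_cons.comp (ha.prodMk hl)

@[fun_prop]
theorem reverse {l : γ → List α} (hl : PolyTime l) : PolyTime fun x => (l x).reverse := by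
  have h : PolyTime fun x => (l x).foldl (fun r a => a :: r) [] :=
    foldl_of_growth (step := fun _ r a => a :: r) hl (by fun_prop) (by fun_prop)
      ⟨Polynomial.X + 1, fun x s a => by simp; omega⟩
  simpa using h

@[fun_prop]
theorem append {l l' : γ → List α} (hl : PolyTime l) (hl' : PolyTime l') :
    PolyTime fun x => l x ++ l' x := by
  have h : PolyTime fun x => (l x).reverse.foldl (fun r a => a :: r) (l' x) :=
    foldl_of_growth (step := fun _ r a => a :: r) (by fun_prop) hl' (by fun_prop)
      ⟨Polynomial.X + 1, fun x s a => by simp; omega⟩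
  simpa using h

theorem foldr_of_growth {l : γ → List α} {s₀ : γ → σ} {step : γ → α → σ → σ} (hl : PolyTime l)
    (hs : PolyTime s₀) (hstep : PolyTime fun q : γ × σ × α => step q.1 q.2.2 q.2.1)
    (hQ : ∃ Q : Polynomial ℕ, ∀ x s a, size (step x a s) ≤ size s + Q.eval (size x + size a)) :
    PolyTime fun x => (l x).foldr (step x) (s₀ x) := by
  have h : PolyTime fun x => (l x).reverse.foldl (fun s a => step x a s) (s₀ x) :=
    foldl_of_growth (step := fun x s a => step x a s) (by fun_prop) hs hstep hQ
  simpa using h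

@[fun_prop]
theorem flatMap {l : γ → List α} {f : γ → α → List β} (hf : PolyTime fun q : γ × α => f q.1 q.2)
    (hl : PolyTime l) : PolyTime fun x => (l x).flatMap (f x) := by
  obtain ⟨Q, hQ⟩ := hf.size_le
  have hf' : PolyTime fun q : γ × List β × α => f q.1 q.2.2 :=
    hf.comp (g := fun q : γ × List β × α => (q.1, q.2.2)) (by fun_prop)
  have h : PolyTime fun x => (l x).foldr (fun a r => f x a ++ r) [] := by
    refine foldr_of_growth (step := fun x a r => f x a ++ r) hl (by fun_prop) (by fun_prop)
      ⟨Q.comp (Polynomial.X + 1), fun x s a => ?_⟩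
    have h1 := size_append (f x a) s
    have h2 := hQ (x, a)
    simp only [size_prod] at h2
    simp only [Polynomial.eval_comp, Polynomial.eval_add, Polynomial.eval_X, Polynomial.eval_one]
    omega
  have e : ∀ x, (l x).foldr (fun a r => f x a ++ r) [] = (l x).flatMap (f x) := by
    intro x
    induction l x with
    | nil => rfl
    | cons a l ih => simp [ih]
  simpa only [e] using h

@[fun_prop]
theorem map {l : γ → List α} {f : γ → α → β} (hf : PolyTime fun q : γ × α => f q.1 q.2)
    (hl : PolyTime l) : PolyTime fun x => (l x).map (f x) := by
  have h : PolyTime fun x => (l x).flatMap fun a => [f x a] := by fun_prop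
  have e : ∀ x, ((l x).flatMap fun a => [f x a]) = (l x).map (f x) := by
    intro x
    induction l x with
    | nil => rfl
    | cons a l ih => simp [ih]
  simpa only [e] using h

theorem natToList : PolyTime fun n : ℕ => List.replicate n () := of_enc_eq fun _ => rfl

theorem listToNat : PolyTime fun l : List Unit => l.length :=
  of_enc_eq fun l => by
    have : List.replicate l.length () = l := List.eq_replicate_of_mem (fun _ _ => rfl) |>.symm
    exact congrArg (fun l => (listTree l).bits) this

@[fun_prop]
theorem length {l : γ → List α} (hl : PolyTime l) : PolyTime fun x => (l x).length := by
  have h : PolyTime fun x => ((l x).map fun _ => ()).length := listToNat.comp (by fun_prop)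
  simpa using h

@[fun_prop]
theorem tail {l : γ → List α} (hl : PolyTime l) : PolyTime fun x => (l x).tail := by
  have h := listCases (f := fun _ => []) (g := fun _ _ (t : List α) => t) hl (by fun_prop)
    (by fun_prop)
  convert h using 2 with x
  cases l x <;> rfl

end Lists

section Booleans

theorem boolToList : PolyTime fun b : Bool => bif b then [()] else [] :=
  of_enc_eq fun b => by cases b <;> rfl

@[fun_prop]
theorem cond {b : γ → Bool} {f g : γ → α} (hb : PolyTime b) (hf : PolyTime f) (hg : PolyTime g) :
    PolyTime fun x => bif b x then f x else g x := by
  have h := listCases (f := g) (g := fun x _ _ => f x) (boolToList.comp hb) hg (by fun_prop)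
  convert h using 2 with x
  cases b x <;> rfl

@[fun_prop]
theorem not {b : γ → Bool} (hb : PolyTime b) : PolyTime fun x => !b x := by
  have h : PolyTime fun x => bif b x then false else true := by fun_prop
  convert h using 2 with x
  cases b x <;> rfl

@[fun_prop]
theorem and {b c : γ → Bool} (hb : PolyTime b) (hc : PolyTime c) :
    PolyTime fun x => b x && c x := by
  have h : PolyTime fun x => bif b x then c x else false := by fun_prop
  convert h using 2 with x
  cases b x <;> rfl

@[fun_prop]
theorem or {b c : γ → Bool} (hb : PolyTime b) (hc : PolyTime c) :
    PolyTime fun x => b x || c x := by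
  have h : PolyTime fun x => bif b x then true else c x := by fun_prop
  convert h using 2 with x
  cases b x <;> rfl

@[fun_prop]
theorem decide_bool_eq {b c : γ → Bool} (hb : PolyTime b) (hc : PolyTime c) :
    PolyTime fun x => decide (b x = c x) := by
  have h : PolyTime fun x => bif b x then c x else !c x := by fun_prop
  convert h using 2 with x
  cases b x <;> cases c x <;> rfl

theorem isNil {l : γ → List α} (hl : PolyTime l) : PolyTime fun x => (l x).isEmpty := by
  have h := listCases (f := fun _ => true) (g := fun _ _ _ => false) hl (by fun_prop) (by fun_prop)
  convert h using 2 with x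
  cases l x <;> rfl

end Booleans

section Options

theorem toList : PolyTime fun o : Option α => o.toList := of_enc_eq fun _ => rfl

@[fun_prop]
theorem some {f : γ → α} (hf : PolyTime f) : PolyTime fun x => some (f x) := by
  have h2 : PolyTime fun a : α => Option.some a := by
    obtain ⟨p, T, hp⟩ := (by fun_prop : PolyTime fun a : α => [a])
    exact ⟨p, T, hp⟩
  exact h2.comp hf

@[fun_prop]
theorem optionElim {o : γ → Option α} {f : γ → β} {g : γ → α → β} (ho : PolyTime o)
    (hf : PolyTime f) (hg : PolyTime fun q : γ × α => g q.1 q.2) :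
    PolyTime fun x => (o x).elim (f x) (g x) := by
  have h := listCases (f := f) (g := fun x a _ => g x a) (toList.comp ho) hf
    (hg.comp (g := fun q : γ × α × List α => (q.1, q.2.1)) (by fun_prop))
  convert h using 2 with x
  cases o x <;> rfl

@[fun_prop]
theorem optionMap {o : γ → Option α} {f : γ → α → β} (ho : PolyTime o)
    (hf : PolyTime fun q : γ × α => f q.1 q.2) : PolyTime fun x => (o x).map (f x) := by
  have h : PolyTime fun x => (o x).elim none fun a => Option.some (f x a) := by fun_prop
  convert h using 2 with x
  cases o x <;> rfl

@[fun_prop]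
theorem head? {l : γ → List α} (hl : PolyTime l) : PolyTime fun x => (l x).head? := by
  have h := listCases (f := fun _ => (none : Option α)) (g := fun _ a _ => Option.some a) hl
    (by fun_prop) (by fun_prop)
  convert h using 2 with x
  cases l x <;> rfl

@[fun_prop]
theorem getD {o : γ → Option α} {d : γ → α} (ho : PolyTime o) (hd : PolyTime d) :
    PolyTime fun x => (o x).getD (d x) := by
  have h : PolyTime fun x => (o x).elim (d x) fun a => a := by fun_prop
  convert h using 2 with x
  cases o x <;> rfl

@[fun_prop]
theorem isNone {o : γ → Option α} (ho : PolyTime o) : PolyTime fun x => (o x).isNone := by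
  have h : PolyTime fun x => (o x).elim true fun _ => false := by fun_prop
  convert h using 2 with x
  cases o x <;> rfl

end Options

section Search

@[fun_prop]
theorem filter {l : γ → List α} {p : γ → α → Bool} (hp : PolyTime fun q : γ × α => p q.1 q.2)
    (hl : PolyTime l) : PolyTime fun x => (l x).filter (p x) := by
  have h : PolyTime fun x => (l x).flatMap fun a => bif p x a then [a] else [] := by fun_prop
  have e : ∀ x, ((l x).flatMap fun a => bif p x a then [a] else []) = (l x).filter (p x) := by
    intro x
    induction l x with
    | nil => rfl
    | cons a l ih => cases h : p x a <;> simp [h, ih]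
  simpa only [e] using h

@[fun_prop]
theorem find? {l : γ → List α} {p : γ → α → Bool} (hp : PolyTime fun q : γ × α => p q.1 q.2)
    (hl : PolyTime l) : PolyTime fun x => (l x).find? (p x) := by
  have h : PolyTime fun x => ((l x).filter (p x)).head? := by fun_prop
  simpa using h

@[fun_prop]
theorem any {l : γ → List α} {p : γ → α → Bool} (hl : PolyTime l)
    (hp : PolyTime fun q : γ × α => p q.1 q.2) : PolyTime fun x => (l x).any (p x) := by
  have h : PolyTime fun x => !((l x).find? (p x)).isNone := by fun_prop
  convert h using 2 with x
  rw [Bool.eq_iff_iff]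
  simp

@[fun_prop]
theorem all {l : γ → List α} {p : γ → α → Bool} (hl : PolyTime l)
    (hp : PolyTime fun q : γ × α => p q.1 q.2) : PolyTime fun x => (l x).all (p x) := by
  have h : PolyTime fun x => !(l x).any fun a => !p x a := by fun_prop
  convert h using 2 with x
  rw [Bool.eq_iff_iff]
  simp

end Search

section Numbers

@[fun_prop]
theorem add {f g : γ → ℕ} (hf : PolyTime f) (hg : PolyTime g) : PolyTime fun x => f x + g x := by
  have h : PolyTime fun x => (List.replicate (f x) () ++ List.replicate (g x) ()).length :=
    listToNat.comp ((natToList.comp hf).append (natToList.comp hg))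
  simpa using h

@[fun_prop]
theorem mul {f g : γ → ℕ} (hf : PolyTime f) (hg : PolyTime g) : PolyTime fun x => f x * g x := by
  have hr : PolyTime fun q : γ × Unit => List.replicate (g q.1) () :=
    natToList.comp (hg.comp fst)
  have h : PolyTime fun x =>
      ((List.replicate (f x) ()).flatMap fun _ => List.replicate (g x) ()).length :=
    listToNat.comp (flatMap hr (natToList.comp hf))
  simpa using h

@[fun_prop]
theorem pred {f : γ → ℕ} (hf : PolyTime f) : PolyTime fun x => f x - 1 := by
  have h : PolyTime fun x => (List.replicate (f x) ()).tail.length :=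
    listToNat.comp (natToList.comp hf).tail
  simpa using h

@[fun_prop]
theorem sub {f g : γ → ℕ} (hf : PolyTime f) (hg : PolyTime g) : PolyTime fun x => f x - g x := by
  have h : PolyTime fun x => (List.replicate (g x) ()).foldl (fun n _ => n - 1) (f x) :=
    foldl_of_growth (step := fun _ n _ => n - 1) (natToList.comp hg) hf (by fun_prop)
      ⟨0, fun x s a => by simp⟩
  have e : ∀ m n : ℕ, (List.replicate m ()).foldl (fun n _ => n - 1) n = n - m := by
    intro m
    induction m with
    | zero => simp
    | succ m ih => intro n; rw [List.replicate_succ, List.foldl_cons, ih]; omega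
  simpa only [e] using h

@[fun_prop]
theorem decide_le {f g : γ → ℕ} (hf : PolyTime f) (hg : PolyTime g) :
    PolyTime fun x => decide (f x ≤ g x) := by
  have h : PolyTime fun x => (List.replicate (f x - g x) ()).isEmpty :=
    isNil (natToList.comp (hf.sub hg))
  convert h using 2 with x
  rw [Bool.eq_iff_iff]
  simp only [decide_eq_true_eq, List.isEmpty_iff, List.replicate_eq_nil_iff]
  omega

@[fun_prop]
theorem decide_lt {f g : γ → ℕ} (hf : PolyTime f) (hg : PolyTime g) :
    PolyTime fun x => decide (f x < g x) := by
  have h : PolyTime fun x => decide (f x + 1 ≤ g x) := by fun_prop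
  exact h

@[fun_prop]
theorem decide_eq {f g : γ → ℕ} (hf : PolyTime f) (hg : PolyTime g) :
    PolyTime fun x => decide (f x = g x) := by
  have h : PolyTime fun x => decide (f x ≤ g x) && decide (g x ≤ f x) := by fun_prop
  convert h using 2 with x
  rw [Bool.eq_iff_iff]
  simp only [decide_eq_true_eq, Bool.and_eq_true]
  omega

@[fun_prop]
theorem range {f : γ → ℕ} (hf : PolyTime f) : PolyTime fun x => List.range (f x) := by
  have h : PolyTime fun x => ((List.replicate (f x) ()).foldl
      (fun l _ => l.length :: l) ([] : List ℕ)).reverse := by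
    refine reverse (foldl (step := fun _ (l : List ℕ) _ => l.length :: l) (natToList.comp hf)
      (by fun_prop) (by fun_prop) ?_)
    obtain ⟨Q, hQ⟩ := hf.size_le
    refine ⟨Q * (2 * Q + 1 + 1) + 1, fun x l' hl' => ?_⟩
    have h1 : ∀ l : List Unit, (∀ k ∈ l.foldl (fun l _ => l.length :: l) ([] : List ℕ),
        k < l.length) ∧ (l.foldl (fun l _ => l.length :: l) ([] : List ℕ)).length = l.length := by
      intro l
      induction l using List.reverseRecOn with
      | nil => simp
      | append_singleton l a ih =>
        rw [List.foldl_append]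
        simp only [List.foldl_cons, List.foldl_nil, List.length_append, List.length_cons,
          List.length_nil, List.mem_cons, ih.2]
        refine ⟨fun k hk => ?_, trivial⟩
        rcases hk with rfl | hk
        · omega
        · have := ih.1 k hk; omega
    have h2 : l'.length ≤ f x := by simpa using hl'.length_le
    have h3 : f x ≤ Q.eval (size x) := by have := hQ x; simp at this; omega
    refine (size_list_le (N := 2 * Q.eval (size x) + 1) fun k hk => ?_).trans ?_
    · have := (h1 l').1 k hk
      simp; omega
    · rw [(h1 l').2]
      simp only [Polynomial.eval_add, Polynomial.eval_mul, Polynomial.eval_ofNat,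
        Polynomial.eval_one]
      gcongr
      omega
  have e : ∀ n, ((List.replicate n ()).foldl (fun l _ => l.length :: l) ([] : List ℕ)).reverse =
      List.range n := by
    intro n
    induction n with
    | zero => rfl
    | succ n ih =>
      have ih' := congrArg List.length ih
      simp only [List.length_reverse, List.length_range] at ih'
      rw [List.replicate_succ', List.foldl_append, List.range_succ, ← ih]
      simp [ih']
  simpa only [e] using h

@[fun_prop]
theorem drop {l : γ → List α} {k : γ → ℕ} (hl : PolyTime l) (hk : PolyTime k) :
    PolyTime fun x => (l x).drop (k x) := by
  have h : PolyTime fun x => (List.replicate (k x) ()).foldl (fun l _ => l.tail) (l x) :=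
    foldl_of_growth (step := fun _ l _ => l.tail) (natToList.comp hk) hl (by fun_prop)
      ⟨0, fun x s a => by simpa using size_le_of_sublist (List.tail_sublist s)⟩
  have e : ∀ (m : ℕ) (l : List α), (List.replicate m ()).foldl (fun l _ => l.tail) l = l.drop m := by
    intro m
    induction m with
    | zero => simp
    | succ m ih => intro l; rw [List.replicate_succ, List.foldl_cons, ih]; simp
  simpa only [e] using h

@[fun_prop]
theorem getElem? {l : γ → List α} {k : γ → ℕ} (hl : PolyTime l) (hk : PolyTime k) :
    PolyTime fun x => (l x)[k x]? := by
  have h : PolyTime fun x => ((l x).drop (k x)).head? := by fun_prop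
  simpa using h

end Numbers

end PolyTime

end ProofAnalysis

/-! ### From polynomial time functions to search problems in `FP` -/

namespace ProofAnalysis

namespace Prog

/-- Move the raw input to the stack `b`; the `true` on `d` says that the input may continue. -/
def readLoop : Prog :=
  .loop .d (.pop .a .skip
    (.seq (.seq (.push .b true) (.push .b true)) (.push .d true))
    (.seq (.seq (.push .b false) (.push .b true)) (.push .d true)))

/-- Write the code of a list of bits, which is read from the stack `b`. -/
def encodeLoop : Prog :=
  .loop .b (.pop .b .skip (pushAll (true :: enc true)) (pushAll (true :: enc false)))

/-- Decode a list of bits, and move it to the stack `b`. -/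
def decodeLoop : Prog :=
  .loop .a (.pop .a .skip
    (.seq (.pop .a .skip .skip .skip) (.seq (.pop .a .skip .skip .skip)
      (.seq (.push .b true) (.push .b true))))
    (.seq (.push .b false) (.push .b true)))

end Prog

theorem reach_readLoop (w : List Bool) : ∀ b,
    Reach Prog.readLoop (mem w b [] [true]) (mem [] (flagged w.reverse ++ b) [] [])
      (5 * w.length + 4) := by
  induction w with
  | nil =>
    intro b
    refine (Reach.loopTrue (S := mem [] b [] [true]) (l := []) (S' := mem [] b [] []) (T := 2)
      (T' := 1) rfl ?_ (Reach.loopNone rfl)).mono (by simp)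
    rw [update_mem_d]
    exact Reach.popNone rfl Reach.skip
  | cons v w ih =>
    intro b
    rw [List.reverse_cons, flagged_append, List.append_assoc]
    refine (Reach.loopTrue (S := mem (v :: w) b [] [true]) (l := []) (T := 4) rfl ?_
      (ih (true :: v :: b))).mono (by simp; omega)
    rw [update_mem_d]
    cases v
    · refine Reach.popFalse (T := 3) rfl ?_
      rw [update_mem_a]
      exact (Reach.push_b.seq Reach.push_b).seq Reach.push_d
    · refine Reach.popTrue (T := 3) rfl ?_
      rw [update_mem_a]
      exact (Reach.push_b.seq Reach.push_b).seq Reach.push_d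

theorem reach_encodeLoop (w : List Bool) : ∀ l : List Bool,
    Reach Prog.encodeLoop (mem (enc l) (flagged w) [] []) (mem (enc (w.reverse ++ l)) [] [] [])
      (7 * w.length + 1) := by
  induction w with
  | nil => exact fun l => Reach.loopNone rfl
  | cons v w ih =>
    intro l
    rw [List.reverse_cons, List.append_assoc]
    refine (Reach.loopTrue (S := mem (enc l) (flagged (v :: w)) [] []) (l := v :: flagged w)
      (T := 6) rfl ?_ (ih (v :: l))).mono (by simp; omega)
    rw [update_mem_b]
    have h := (Does.pushAll (true :: enc v)) (enc l) (flagged w) [] []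
    rw [List.nil_append] at h
    cases v
    · refine Reach.popFalse (T := 5) rfl ?_
      rw [update_mem_b]
      exact h.mono (by decide)
    · refine Reach.popTrue (T := 5) rfl ?_
      rw [update_mem_b]
      exact h.mono (by decide)

theorem reach_decodeLoop (w : List Bool) : ∀ b : List Bool,
    Reach Prog.decodeLoop (mem (enc w) b [] []) (mem [] (flagged w.reverse ++ b) [] [])
      (8 * w.length + 1) := by
  induction w with
  | nil =>
    intro b
    have h := Reach.loopFalse (S := mem (enc ([] : List Bool)) b [] []) (k := .a) (l := [])
      (p := .pop .a .skip
        (.seq (.pop .a .skip .skip .skip) (.seq (.pop .a .skip .skip .skip)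
          (.seq (.push .b true) (.push .b true))))
        (.seq (.push .b false) (.push .b true))) rfl
    rw [update_mem_a] at h
    exact h
  | cons v w ih =>
    intro b
    rw [List.reverse_cons, flagged_append, List.append_assoc]
    refine (Reach.loopTrue (S := mem (enc (v :: w)) b [] []) (l := enc v ++ enc w)
      (T := 7) rfl ?_ (ih (true :: v :: b))).mono (by simp; omega)
    rw [update_mem_a]
    have hpop (R : List Bool) : Reach (.pop .a .skip .skip .skip) (mem (false :: R) b [] [])
        (mem R b [] []) 2 := by
      refine Reach.popFalse (T := 1) rfl ?_
      rw [update_mem_a]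
      exact Reach.skip
    cases v
    · refine (Reach.popFalse (l := enc w) (T := 2) rfl ?_).mono (by omega)
      rw [update_mem_a]
      exact Reach.push_b.seq Reach.push_b
    · refine Reach.popTrue (l := false :: false :: enc w) (T := 6) rfl ?_
      rw [update_mem_a]
      exact (hpop _).seq ((hpop _).seq (Reach.push_b.seq Reach.push_b))

theorem size_bits_le (w : List Bool) : size w ≤ 4 * w.length + 1 := by
  have := size_list_le (l := w) (N := 3) fun b _ => size_bool_le b
  omega

/-- Polynomial time functions in the sense of `PolyTime` are computed by Turing machines in
polynomial time. -/
theorem PolyTime.computable {f : List Bool → List Bool} (hf : PolyTime f) :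
    Nonempty (Turing.TM2ComputableInPolyTime (id : List Bool → List Bool) id f) := by
  obtain ⟨Q, hQ⟩ := hf.size_le
  obtain ⟨p, T, hp⟩ := hf
  let Z : Polynomial ℕ := 4 * Polynomial.X + 1
  refine computableInPolyTime_of_run
    (.seq (.seq (.push .d true) .readLoop) (.seq (.seq (.push .a false) .encodeLoop)
      (.seq p (.seq (.seq (.push .b false) .decodeLoop) (.back .b)))))
    (20 * Polynomial.X + 20 + T.comp Z + 20 * Q.comp Z) fun w => ?_
  have h1 := reach_readLoop w []
  have h2 := reach_encodeLoop w.reverse []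
  have h3 := hp w [] [] [] []
  have h4 := reach_decodeLoop (f w) [false]
  have h5 := reach_back_b (f w).reverse [] [] [] []
  simp only [List.append_nil, List.reverse_reverse, List.length_reverse] at h1 h2 h3 h5
  refine ((Reach.push_d.seq h1).seq ((Reach.push_a.seq h2).seq (h3.seq
    ((Reach.push_b.seq h4).seq h5)))).mono ?_
  have k1 := eval_mono T (size_bits_le w)
  have k2 := (hQ w).trans (eval_mono Q (size_bits_le w))
  have k3 := length_lt_size (f w)
  simp only [Polynomial.eval_add, Polynomial.eval_mul, Polynomial.eval_comp, Polynomial.eval_X,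
    Polynomial.eval_ofNat, Polynomial.eval_one, Z]
  omega

theorem inFP_of_polyTime {R : SearchProblem} {f : List Bool → List Bool} (hf : PolyTime f)
    (h : ∀ x, (∃ y, (x, y) ∈ R) → (x, f x) ∈ R) : InFP R :=
  ⟨f, hf.computable, h⟩

end ProofAnalysis

/-! ### The algorithm -/

namespace ProofAnalysis

/-- A variable of `Ref_s(φ)` as it is read from the input: the three bits of its tag, its block, a
second index (or `0`), and the sign of a literal of `φ` (or `false`). -/
abbrev RawVar := (Bool × Bool × Bool) × ℕ × ℕ × Bool

/-- A clause of a refutation as it is read from the input. -/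
abbrev RawClause := List (RawVar × Bool)

/-- A clause of `φ` as it is read from the input. -/
abbrev RawCnfClause := List (ℕ × Bool)

/-- The level of a block: level `0` holds only the root, and each of the levels `1, …, n` holds the
next `24 * n` blocks. The remaining blocks get the level `n + 1`, and are not used. -/
def level (n s B : ℕ) : ℕ :=
  ((List.range (n + 1)).filter fun k => decide (24 * n * k < s - 1 - B)).length

/-- The variable says that a block is enabled. -/
def isEnable (v : RawVar) : Bool := !v.1.1 && !v.1.2.1 && !v.1.2.2

/-- The clause `E` contains a variable of the block `B` other than the enabling variable. -/
def mentions (E : RawClause) (B : ℕ) : Bool :=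
  E.any fun l => !isEnable l.1 && decide (l.1.2.1 = B)

/-- The clause `E` is satisfied when all variables of the block `p.1` other than the enabling
variable get the value `p.2`. -/
def kills (p : ℕ × Bool) (E : RawClause) : Bool :=
  E.any fun l => !isEnable l.1 && decide (l.1.2.1 = p.1) && decide (l.2 = p.2)

/-- The clause `E` is satisfied by the restriction `D`, a list of disabled blocks together with the
value that the variables of the block get. -/
def killed (D : List (ℕ × Bool)) (E : RawClause) : Bool := D.any fun p => kills p E

/-- The value of the variables of a disabled block, and `none` for an enabled block. -/
def off (n s : ℕ) (D : List (ℕ × Bool)) (B : ℕ) : Option Bool :=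
  bif decide (n < level n s B) then some false else (D.find? fun p => decide (p.1 = B)).map Prod.snd

/-- The enabled blocks at level `k` that are mentioned in the clause `E`. -/
def mentioned (n s : ℕ) (D : List (ℕ × Bool)) (k : ℕ) (E : RawClause) : List ℕ :=
  (List.range s).filter fun B =>
    decide (level n s B = k) && (off n s D B).isNone && mentions E B

/-- The clauses in `π` that are not satisfied by the restriction, and mention more than `4 * n`
enabled blocks at level `k`. -/
def wide (n s : ℕ) (π : List RawClause) (D : List (ℕ × Bool)) (k : ℕ) : List RawClause :=
  π.filter fun E => !killed D E && decide (4 * n < (mentioned n s D k E).length)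

/-- Disabling the block `p.1` with the value `p.2` kills at least a twelfth of the wide clauses at
its level. -/
def eligible (n s : ℕ) (π : List RawClause) (D : List (ℕ × Bool)) (p : ℕ × Bool) : Bool :=
  decide (1 ≤ level n s p.1) && (off n s D p.1).isNone &&
    decide (0 < (wide n s π D (level n s p.1)).length) &&
    decide ((wide n s π D (level n s p.1)).length ≤
      12 * ((wide n s π D (level n s p.1)).filter (kills p)).length)

/-- The ways to disable one of the blocks. -/
def disablings (s : ℕ) : List (ℕ × Bool) :=
  (List.range s).map (fun B => (B, false)) ++ (List.range s).map (fun B => (B, true))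

/-- Disable an eligible block, if there is one. -/
def greedyStep (n s : ℕ) (π : List RawClause) (D : List (ℕ × Bool)) : List (ℕ × Bool) :=
  ((disablings s).find? (eligible n s π D)).elim D fun p => p :: D

/-- The restriction that is obtained by disabling eligible blocks as long as possible. -/
def greedy (n s : ℕ) (π : List RawClause) : List (ℕ × Bool) :=
  (List.range s).foldl (fun D _ => greedyStep n s π D) []

/-- What is known about a block: the block `r.1`, an assignment `r.2.1` to the first variables of
`φ` that falsifies exactly the literals present in the block, and the two blocks `r.2.2.1` and
`r.2.2.2` from which it was resolved. -/
abbrev Record := ℕ × List Bool × ℕ × ℕ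

/-- The partial assignment `u` falsifies the literal; variables without a value falsify nothing. -/
def falsifiesLit (u : List Bool) (l : ℕ × Bool) : Bool := !decide (u[l.1]?.getD l.2 = l.2)

/-- The value of a variable other than an enabling variable according to the record of its block. -/
def recordVal (n : ℕ) (φ : List RawCnfClause) (r : Record) (v : RawVar) : Bool :=
  bif v.1.1 then
    bif v.1.2.1 then decide (v.2.2.1 = r.2.2.2)
    else bif v.1.2.2 then decide (v.2.2.1 = r.2.2.1)
    else decide (v.2.2.1 = r.2.1.length)
  else bif v.1.2.1 then
    bif v.1.2.2 then falsifiesLit r.2.1 v.2.2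
    else (φ[v.2.2.1]?.getD []).all (falsifiesLit r.2.1)
  else decide (r.2.1.length < n)

/-- The value of a variable according to a restriction `D` and a list `M` of records, if it has
one. -/
def val (n : ℕ) (φ : List RawCnfClause) (s : ℕ) (D : List (ℕ × Bool)) (M : List Record)
    (v : RawVar) : Option Bool :=
  bif isEnable v then some (off n s D v.2.1).isNone
  else (off n s D v.2.1).elim
    ((M.find? fun r => decide (r.1 = v.2.1)).map fun r => recordVal n φ r v) fun b => some b

/-- All literals of the clause `E` have a value, namely `false`. -/
def falsified (n : ℕ) (φ : List RawCnfClause) (s : ℕ) (D : List (ℕ × Bool)) (M : List Record)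
    (E : RawClause) : Bool :=
  E.all fun l => !decide ((val n φ s D M l.1).getD l.2 = l.2)

/-- The block `B` occurs in one of the records. -/
def isUsed (M : List Record) (B : ℕ) : Bool :=
  M.any fun r => decide (r.1 = B) || decide (r.2.2.1 = B) || decide (r.2.2.2 = B)

/-- The enabled blocks at level `k` that do not occur in the records. -/
def fresh (n s : ℕ) (D : List (ℕ × Bool)) (M : List Record) (k : ℕ) : List ℕ :=
  (List.range s).filter fun B =>
    decide (level n s B = k) && (off n s D B).isNone && !isUsed M B

/-- The assignment for the block `B` that is enforced by the record of a block that was resolved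
from `B`, and otherwise the empty one. -/
def inherited (M : List Record) (B : ℕ) : List Bool :=
  (M.find? fun r => decide (r.2.2.1 = B) || decide (r.2.2.2 = B)).elim []
    fun r => r.2.1 ++ [decide (r.2.2.2 = B)]

/-- A new record for the block `B`. At level `n`, no fresh blocks exist at the next level, and the
entries for the blocks from which `B` was resolved get the dummy value `s`. -/
def newRecord (n s : ℕ) (D : List (ℕ × Bool)) (M : List Record) (B : ℕ) : Record :=
  (B, (List.range (level n s B)).map (fun j => (inherited M B)[j]?.getD false),
    (fresh n s D M (level n s B + 1))[0]?.getD s, (fresh n s D M (level n s B + 1))[1]?.getD s)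

/-- Extend the records by a record for the block `B`, unless the block is disabled or already has a
record. -/
def query (n s : ℕ) (D : List (ℕ × Bool)) (M : List Record) (B : ℕ) : List Record :=
  bif (off n s D B).isNone && (M.find? fun r => decide (r.1 = B)).isNone then
    newRecord n s D M B :: M
  else M

/-- Move to the clause `E`, if it becomes falsified by querying some block, and forget the records
of all blocks that are not mentioned in `E`. -/
def walkStep (n : ℕ) (φ : List RawCnfClause) (s : ℕ) (D : List (ℕ × Bool)) (M : List Record)
    (E : RawClause) : List Record :=
  ((List.range s).find? fun B => falsified n φ s D (query n s D M B) E).elim M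
    fun B => (query n s D M B).filter fun r => mentions E r.1

/-- Walk through the refutation from its end to its beginning along falsified clauses. -/
def walk (n : ℕ) (φ : List RawCnfClause) (s : ℕ) (D : List (ℕ × Bool)) (π : List RawClause) :
    List Record :=
  π.foldr (fun E M => walkStep n φ s D M E) []

/-- The assignments given by the binary representations of the numbers below `N`. -/
def bruteForce (n N : ℕ) : List (List Bool) :=
  (List.range N).map fun c => (List.range n).map fun j => c.testBit j

/-- The assignment `u` satisfies `φ`; variables without a value satisfy nothing. -/
def satisfies (φ : List RawCnfClause) (u : List Bool) : Bool :=
  φ.all fun C => C.any fun l => decide (u[l.1]?.getD (!l.2) = l.2)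

/-- The number of assignments that are tried even if the refutation is short; it takes care of the
formulas with at most 25 variables. -/
def bruteForceBound : ℕ := 2 ^ 25

/-- The assignments that are tried. -/
def candidates (n : ℕ) (φ : List RawCnfClause) (s : ℕ) (π : List RawClause) : List (List Bool) :=
  bruteForce n (π.length + bruteForceBound) ++
    (walk n φ s (greedy n s π) π).map fun r => r.2.1

/-- A satisfying assignment among the candidates. -/
def solve (n : ℕ) (φ : List RawCnfClause) (s : ℕ) (π : List RawClause) : Option (List Bool) :=
  (candidates n φ s π).find? fun u => decide (u.length = n) && satisfies φ u

/-! ### The algorithm runs in polynomial time -/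

namespace PolyTime

variable {γ α β : Type} [Code γ] [Code α] [Code β]

theorem testBit {c j : γ → ℕ} (hc : PolyTime c) (hj : PolyTime j) :
    PolyTime fun x => (c x).testBit (j x) := by
  have hhalf : PolyTime fun c : ℕ => ((List.range c).filter fun k => decide (2 * k + 2 ≤ c)).length :=
    by fun_prop
  have e1 : ∀ c : ℕ, ((List.range c).filter fun k => decide (2 * k + 2 ≤ c)).length = c / 2 := by
    intro c
    have : ∀ m, ((List.range m).filter fun k => decide (2 * k + 2 ≤ c)).length = min m (c / 2) := by
      intro m
      induction m with
      | zero => simp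
      | succ m ih =>
        rw [List.range_succ, List.filter_append, List.length_append, ih]
        by_cases h : 2 * m + 2 ≤ c <;> simp [h] <;> omega
    rw [this]; omega
  simp only [e1] at hhalf
  have h2 : PolyTime fun x => (List.range (j x)).foldl (fun c _ => c / 2) (c x) := by
    refine foldl_of_growth (step := fun _ c _ => c / 2) (by fun_prop) hc
      (hhalf.comp (g := fun q : γ × ℕ × ℕ => q.2.1) (by fun_prop)) ⟨0, fun x s a => ?_⟩
    simp; omega
  have e2 : ∀ j c : ℕ, (List.range j).foldl (fun c _ => c / 2) c = c >>> j := by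
    intro j c
    induction j with
    | zero => rfl
    | succ j ih => rw [List.range_succ, List.foldl_append, ih]; rfl
  simp only [e2] at h2
  have h3 : PolyTime fun x => decide ((c x >>> j x) - 2 * ((c x >>> j x) / 2) = 1) := by
    have := hhalf.comp h2
    fun_prop
  convert h3 using 2 with x
  rw [Nat.testBit, Nat.and_comm, Nat.and_one_is_mod, Bool.eq_iff_iff]
  simp
  omega

attribute [fun_prop] testBit

variable {n s k B : γ → ℕ} {E : γ → RawClause} {p : γ → ℕ × Bool} {D : γ → List (ℕ × Bool)}
  {π : γ → List RawClause} {φ : γ → List RawCnfClause} {M : γ → List Record}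

@[fun_prop]
theorem level (hn : PolyTime n) (hs : PolyTime s) (hB : PolyTime B) :
    PolyTime fun x => level (n x) (s x) (B x) := by
  unfold ProofAnalysis.level; fun_prop

@[fun_prop]
theorem isEnable {v : γ → RawVar} (hv : PolyTime v) : PolyTime fun x => isEnable (v x) := by
  unfold ProofAnalysis.isEnable; fun_prop

@[fun_prop]
theorem mentions (hE : PolyTime E) (hB : PolyTime B) : PolyTime fun x => mentions (E x) (B x) := by
  unfold ProofAnalysis.mentions; fun_prop

@[fun_prop]
theorem kills (hp : PolyTime p) (hE : PolyTime E) : PolyTime fun x => kills (p x) (E x) := by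
  unfold ProofAnalysis.kills; fun_prop

@[fun_prop]
theorem killed (hD : PolyTime D) (hE : PolyTime E) : PolyTime fun x => killed (D x) (E x) := by
  unfold ProofAnalysis.killed; fun_prop

@[fun_prop]
theorem off (hn : PolyTime n) (hs : PolyTime s) (hD : PolyTime D) (hB : PolyTime B) :
    PolyTime fun x => off (n x) (s x) (D x) (B x) := by
  unfold ProofAnalysis.off; fun_prop

@[fun_prop]
theorem mentioned (hn : PolyTime n) (hs : PolyTime s) (hD : PolyTime D) (hk : PolyTime k)
    (hE : PolyTime E) : PolyTime fun x => mentioned (n x) (s x) (D x) (k x) (E x) := by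
  unfold ProofAnalysis.mentioned; fun_prop

@[fun_prop]
theorem wide (hn : PolyTime n) (hs : PolyTime s) (hπ : PolyTime π) (hD : PolyTime D)
    (hk : PolyTime k) : PolyTime fun x => wide (n x) (s x) (π x) (D x) (k x) := by
  unfold ProofAnalysis.wide; fun_prop

@[fun_prop]
theorem eligible (hn : PolyTime n) (hs : PolyTime s) (hπ : PolyTime π) (hD : PolyTime D)
    (hp : PolyTime p) : PolyTime fun x => eligible (n x) (s x) (π x) (D x) (p x) := by
  unfold ProofAnalysis.eligible; fun_prop

@[fun_prop]
theorem disablings (hs : PolyTime s) : PolyTime fun x => disablings (s x) := by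
  unfold ProofAnalysis.disablings; fun_prop

@[fun_prop]
theorem greedyStep (hn : PolyTime n) (hs : PolyTime s) (hπ : PolyTime π) (hD : PolyTime D) :
    PolyTime fun x => greedyStep (n x) (s x) (π x) (D x) := by
  unfold ProofAnalysis.greedyStep; fun_prop

theorem size_greedyStep_le (n s : ℕ) (π : List RawClause) (D : List (ℕ × Bool)) :
    size (ProofAnalysis.greedyStep n s π D) ≤ size D + (2 * s + 6) := by
  unfold ProofAnalysis.greedyStep
  cases hp : (ProofAnalysis.disablings s).find? (ProofAnalysis.eligible n s π D) with
  | none => simp only [Option.elim_none]; omega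
  | some p =>
    have h1 := List.mem_of_find?_eq_some hp
    have h2 := size_bool_le p.2
    have h3 : p.1 < s := by
      simp [ProofAnalysis.disablings] at h1
      rcases h1 with ⟨a, h, rfl⟩ | ⟨a, h, rfl⟩ <;> exact h
    obtain ⟨p, b⟩ := p
    simp at h2 h3 ⊢
    omega

@[fun_prop]
theorem greedy (hn : PolyTime n) (hs : PolyTime s) (hπ : PolyTime π) :
    PolyTime fun x => greedy (n x) (s x) (π x) := by
  unfold ProofAnalysis.greedy
  obtain ⟨Q, hQ⟩ := hs.size_le
  refine foldl_of_growth (step := fun x D _ => ProofAnalysis.greedyStep (n x) (s x) (π x) D)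
    (by fun_prop) (by fun_prop) (by fun_prop) ⟨Q + 6, fun x D a => ?_⟩
  have h1 := size_greedyStep_le (n x) (s x) (π x) D
  have h2 := (hQ x).trans (eval_mono Q (Nat.le_add_right (size x) (size a)))
  rw [size_nat (s x)] at h2
  simp only [Polynomial.eval_add, Polynomial.eval_ofNat]
  omega

@[fun_prop]
theorem falsifiesLit {u : γ → List Bool} {l : γ → ℕ × Bool} (hu : PolyTime u) (hl : PolyTime l) :
    PolyTime fun x => falsifiesLit (u x) (l x) := by
  unfold ProofAnalysis.falsifiesLit; fun_prop

@[fun_prop]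
theorem recordVal {r : γ → Record} {v : γ → RawVar} (hn : PolyTime n) (hφ : PolyTime φ)
    (hr : PolyTime r) (hv : PolyTime v) :
    PolyTime fun x => recordVal (n x) (φ x) (r x) (v x) := by
  unfold ProofAnalysis.recordVal; fun_prop

@[fun_prop]
theorem val {v : γ → RawVar} (hn : PolyTime n) (hφ : PolyTime φ) (hs : PolyTime s)
    (hD : PolyTime D) (hM : PolyTime M) (hv : PolyTime v) :
    PolyTime fun x => val (n x) (φ x) (s x) (D x) (M x) (v x) := by
  unfold ProofAnalysis.val; fun_prop

@[fun_prop]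
theorem falsified (hn : PolyTime n) (hφ : PolyTime φ) (hs : PolyTime s)
    (hD : PolyTime D) (hM : PolyTime M) (hE : PolyTime E) :
    PolyTime fun x => falsified (n x) (φ x) (s x) (D x) (M x) (E x) := by
  unfold ProofAnalysis.falsified; fun_prop

@[fun_prop]
theorem isUsed (hM : PolyTime M) (hB : PolyTime B) : PolyTime fun x => isUsed (M x) (B x) := by
  unfold ProofAnalysis.isUsed; fun_prop

@[fun_prop]
theorem fresh (hn : PolyTime n) (hs : PolyTime s) (hD : PolyTime D) (hM : PolyTime M)
    (hk : PolyTime k) : PolyTime fun x => fresh (n x) (s x) (D x) (M x) (k x) := by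
  unfold ProofAnalysis.fresh; fun_prop

@[fun_prop]
theorem inherited (hM : PolyTime M) (hB : PolyTime B) :
    PolyTime fun x => inherited (M x) (B x) := by
  unfold ProofAnalysis.inherited; fun_prop

@[fun_prop]
theorem newRecord (hn : PolyTime n) (hs : PolyTime s) (hD : PolyTime D) (hM : PolyTime M)
    (hB : PolyTime B) : PolyTime fun x => newRecord (n x) (s x) (D x) (M x) (B x) := by
  unfold ProofAnalysis.newRecord; fun_prop

@[fun_prop]
theorem query (hn : PolyTime n) (hs : PolyTime s) (hD : PolyTime D) (hM : PolyTime M)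
    (hB : PolyTime B) : PolyTime fun x => query (n x) (s x) (D x) (M x) (B x) := by
  unfold ProofAnalysis.query; fun_prop

@[fun_prop]
theorem walkStep (hn : PolyTime n) (hφ : PolyTime φ) (hs : PolyTime s)
    (hD : PolyTime D) (hM : PolyTime M) (hE : PolyTime E) :
    PolyTime fun x => walkStep (n x) (φ x) (s x) (D x) (M x) (E x) := by
  unfold ProofAnalysis.walkStep; fun_prop

theorem level_le (n s B : ℕ) : ProofAnalysis.level n s B ≤ n + 1 := by
  unfold ProofAnalysis.level
  exact (List.length_filter_le _ _).trans (by simp)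

theorem fresh_getD_le (n s : ℕ) (D : List (ℕ × Bool)) (M : List Record) (k i : ℕ) :
    (ProofAnalysis.fresh n s D M k)[i]?.getD s ≤ s := by
  cases h : (ProofAnalysis.fresh n s D M k)[i]? with
  | none => simp
  | some B =>
    have := List.mem_of_getElem? h
    simp [ProofAnalysis.fresh] at this
    simp; omega

theorem size_walkStep_le (n : ℕ) (φ : List RawCnfClause) (s : ℕ) (D : List (ℕ × Bool))
    (M : List Record) (E : RawClause) :
    size (ProofAnalysis.walkStep n φ s D M E) ≤ size M + (4 * n + 6 * s + 20) := by
  unfold ProofAnalysis.walkStep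
  cases hB : (List.range s).find? fun B =>
      ProofAnalysis.falsified n φ s D (ProofAnalysis.query n s D M B) E with
  | none => simp only [Option.elim_none]; omega
  | some B =>
    have h0 : B < s := by simpa using List.mem_of_find?_eq_some hB
    refine (size_le_of_sublist List.filter_sublist).trans ?_
    unfold ProofAnalysis.query
    cases (ProofAnalysis.off n s D B).isNone && (M.find? fun r => decide (r.1 = B)).isNone
    · simp
    · have h1 := level_le n s B
      have h2 := fresh_getD_le n s D M (ProofAnalysis.level n s B + 1) 0
      have h3 := fresh_getD_le n s D M (ProofAnalysis.level n s B + 1) 1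
      have h4 := size_bits_le ((List.range (ProofAnalysis.level n s B)).map
        (fun j => (ProofAnalysis.inherited M B)[j]?.getD false))
      simp only [List.length_map, List.length_range] at h4
      simp only [cond_true, ProofAnalysis.newRecord, size_cons, size_prod, size_nat]
      omega

@[fun_prop]
theorem walk (hn : PolyTime n) (hφ : PolyTime φ) (hs : PolyTime s)
    (hD : PolyTime D) (hπ : PolyTime π) :
    PolyTime fun x => walk (n x) (φ x) (s x) (D x) (π x) := by
  unfold ProofAnalysis.walk
  obtain ⟨Q, hQ⟩ := hs.size_le
  obtain ⟨P, hP⟩ := hn.size_le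
  refine foldr_of_growth
    (step := fun x E M => ProofAnalysis.walkStep (n x) (φ x) (s x) (D x) M E)
    hπ (by fun_prop) (by fun_prop) ⟨2 * P + 3 * Q + 20, fun x M E => ?_⟩
  have h1 := size_walkStep_le (n x) (φ x) (s x) (D x) M E
  have h2 := (hQ x).trans (eval_mono Q (Nat.le_add_right (size x) (size E)))
  have h3 := (hP x).trans (eval_mono P (Nat.le_add_right (size x) (size E)))
  rw [size_nat (s x)] at h2
  rw [size_nat (n x)] at h3
  simp only [Polynomial.eval_add, Polynomial.eval_mul, Polynomial.eval_ofNat]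
  omega

@[fun_prop]
theorem candidates (hn : PolyTime n) (hφ : PolyTime φ) (hs : PolyTime s) (hπ : PolyTime π) :
    PolyTime fun x => candidates (n x) (φ x) (s x) (π x) := by
  unfold ProofAnalysis.candidates bruteForce; fun_prop

@[fun_prop]
theorem solve (hn : PolyTime n) (hφ : PolyTime φ) (hs : PolyTime s) (hπ : PolyTime π) :
    PolyTime fun x => solve (n x) (φ x) (s x) (π x) := by
  unfold ProofAnalysis.solve satisfies; fun_prop

end PolyTime

end ProofAnalysis

/-! ### Reading the input -/

namespace ProofAnalysis

section Parsers

variable {α β : Type}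

/-- One round of `parseList`: read another entry of the list, if there is one. -/
def parseStep (p : List Bool → α × List Bool) (S : List α × List Bool) : List α × List Bool :=
  match S.2 with
  | [] => S
  | b :: t => bif b then ((p t).1 :: S.1, (p t).2) else S

/-- Read a list from the front of a bit string, given how to read its entries. As each entry takes at
least one bit, the length of the string is a sufficient number of rounds. -/
def parseList (p : List Bool → α × List Bool) (w : List Bool) : List α × List Bool :=
  ((w.foldl (fun S _ => parseStep p S) ([], w)).1.reverse,
    (w.foldl (fun S _ => parseStep p S) ([], w)).2.tail)

/-- Read a number from the front of a bit string. -/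
def parseNat (w : List Bool) : ℕ × List Bool :=
  ((parseList (fun r => ((), r)) w).1.length, (parseList (fun r => ((), r)) w).2)

/-- Read a literal from the front of a bit string, given how to read a variable. -/
def parseLit (p : List Bool → α × List Bool) (w : List Bool) : (α × Bool) × List Bool :=
  (((p w.tail).1, w.head?.getD false), (p w.tail).2)

/-- Read the block and the further indices of a variable of `Ref_s(φ)` with the given tag. -/
def parseIndices (tag : Bool × Bool × Bool) (w : List Bool) : RawVar × List Bool :=
  bif !tag.1 && !tag.2.1 then ((tag, (parseNat w).1, 0, false), (parseNat w).2)
  else bif !tag.1 && tag.2.2 then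
    ((tag, (parseNat w).1, (parseNat (parseNat w).2.tail).1, (parseNat w).2.head?.getD false),
      (parseNat (parseNat w).2.tail).2)
  else ((tag, (parseNat w).1, (parseNat (parseNat w).2).1, false), (parseNat (parseNat w).2).2)

/-- Read a variable of `Ref_s(φ)` from the front of a bit string. -/
def parseRefVar (w : List Bool) : RawVar × List Bool :=
  parseIndices (w[0]?.getD false, w[1]?.getD false, w[2]?.getD false) (w.drop 3)

/-- Read a sequence of clauses from the front of a bit string. -/
def parseClauses (p : List Bool → α × List Bool) : List Bool → List (List (α × Bool)) × List Bool :=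
  parseList (parseList (parseLit p))

theorem parseStep_suffix {p : List Bool → α × List Bool} (hp : ∀ w, (p w).2 <:+ w)
    (S : List α × List Bool) : (parseStep p S).2 <:+ S.2 := by
  unfold parseStep
  split
  · exact List.suffix_refl _
  · next b t h =>
    cases b
    · exact List.suffix_refl _
    · rw [h]; exact (hp t).trans (List.suffix_cons _ _)

theorem foldl_parseStep_suffix {p : List Bool → α × List Bool} (hp : ∀ w, (p w).2 <:+ w)
    (l : List Bool) : ∀ S : List α × List Bool,
      (l.foldl (fun S _ => parseStep p S) S).2 <:+ S.2 := by
  induction l with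
  | nil => exact fun S => List.suffix_refl _
  | cons b l ih => exact fun S => (ih _).trans (parseStep_suffix hp S)

theorem parseList_suffix {p : List Bool → α × List Bool} (hp : ∀ w, (p w).2 <:+ w)
    (w : List Bool) : (parseList p w).2 <:+ w :=
  (List.tail_suffix _).trans (foldl_parseStep_suffix hp w ([], w))

theorem parseNat_suffix (w : List Bool) : (parseNat w).2 <:+ w :=
  parseList_suffix (fun _ => List.suffix_refl _) w

theorem parseLit_suffix {p : List Bool → α × List Bool} (hp : ∀ w, (p w).2 <:+ w)
    (w : List Bool) : (parseLit p w).2 <:+ w :=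
  (hp _).trans (List.tail_suffix w)

theorem parseRefVar_suffix (w : List Bool) : (parseRefVar w).2 <:+ w := by
  unfold parseRefVar parseIndices
  refine List.IsSuffix.trans ?_ (List.drop_suffix 3 w)
  generalize w.drop 3 = w'
  cases w[0]?.getD false <;> cases w[1]?.getD false <;> cases w[2]?.getD false <;>
    simp only [Bool.not_true, Bool.not_false, Bool.true_and, Bool.false_and, cond_true,
      cond_false] <;>
    first
    | exact parseNat_suffix _
    | exact (parseNat_suffix _).trans ((List.tail_suffix _).trans (parseNat_suffix _))
    | exact (parseNat_suffix _).trans (parseNat_suffix _)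

theorem parseList_encodeList {e : β → List Bool} {p : List Bool → α × List Bool} {g : β → α}
    (h : ∀ b w, p (e b ++ w) = (g b, w)) (L : List β) (w : List Bool) :
    parseList p (encodeList e L ++ w) = (L.map g, w) := by
  have key : ∀ (L : List β) (l : List Bool) (r : List α), L.length ≤ l.length →
      l.foldl (fun S _ => parseStep p S) (r, encodeList e L ++ w) =
        ((L.map g).reverse ++ r, false :: w) := by
    intro L
    induction L with
    | nil =>
      intro l r _
      induction l with
      | nil => rfl
      | cons b l ih => exact ih (by simp)
    | cons b L ih =>
      intro l r hl
      cases l with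
      | nil => simp at hl
      | cons c l =>
        have := ih l (g b :: r) (by simpa using hl)
        have hstep : parseStep p (r, encodeList e (b :: L) ++ w) =
            (g b :: r, encodeList e L ++ w) := by
          simp [parseStep, encodeList, h]
        rw [List.foldl_cons, hstep, this]
        simp
  have hlen : L.length ≤ (encodeList e L ++ w).length := by
    have : ∀ L : List β, L.length ≤ (encodeList e L).length := by
      intro L
      induction L with
      | nil => simp
      | cons b L ih => simp [encodeList]; omega
    have := this L
    simp; omega
  unfold parseList
  rw [key L _ [] hlen]
  simp

theorem parseNat_encodeNat (k : ℕ) (w : List Bool) : parseNat (encodeNat k ++ w) = (k, w) := by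
  have h : encodeNat k = encodeList (fun _ : Unit => []) (List.replicate k ()) := by
    unfold encodeNat
    induction k with
    | zero => rfl
    | succ k ih => rw [List.replicate_succ, List.replicate_succ, List.cons_append, ih]; rfl
  unfold parseNat
  rw [h, parseList_encodeList (g := fun _ => ()) (fun _ _ => rfl)]
  simp

theorem parseLit_encodeLiteral {V : Type} {e : V → List Bool} {p : List Bool → α × List Bool}
    {g : V → α} (h : ∀ v w, p (e v ++ w) = (g v, w)) (l : Literal V) (w : List Bool) :
    parseLit p (encodeLiteral e l ++ w) = ((g l.1, l.2), w) := by
  simp [parseLit, encodeLiteral, h]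

/-- The representation of a variable of `Ref_s(φ)` by indices. -/
def rawVar {n m s : ℕ} : RefVar n m s → RawVar
  | .enable B => ((false, false, false), B, 0, false)
  | .derived B => ((false, false, true), B, 0, false)
  | .weak B A => ((false, true, false), B, A, false)
  | .lit B l => ((false, true, true), B, l.1, l.2)
  | .res B i => ((true, false, false), B, i, false)
  | .lpoint B B' _ => ((true, false, true), B, B', false)
  | .rpoint B B' _ => ((true, true, false), B, B', false)

theorem parseRefVar_encodeRefVar {n m s : ℕ} (v : RefVar n m s) (w : List Bool) :
    parseRefVar (encodeRefVar v ++ w) = (rawVar v, w) := by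
  cases v <;>
    simp [parseRefVar, parseIndices, encodeRefVar, rawVar, encodeLiteral, encodeVar,
      parseNat_encodeNat, List.append_assoc]

/-- The representation of a sequence of clauses by indices. -/
def rawClauses {V : Type} (g : V → α) (L : ClauseList V) : List (List (α × Bool)) :=
  L.map fun C => C.map fun l => (g l.1, l.2)

theorem parseClauses_encodeClauses {V : Type} {e : V → List Bool} {p : List Bool → α × List Bool}
    {g : V → α} (h : ∀ v w, p (e v ++ w) = (g v, w)) (L : ClauseList V) (w : List Bool) :
    parseClauses p (encodeClauses e L ++ w) = (rawClauses g L, w) :=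
  parseList_encodeList (parseList_encodeList (parseLit_encodeLiteral h)) L w

end Parsers

/-- The algorithm: read the input, search a satisfying assignment, and write it. -/
def analyze (w : List Bool) : List Bool :=
  (solve (parseNat w).1 (parseClauses parseNat (parseNat w).2).1
    (parseNat (parseClauses parseNat (parseNat w).2).2).1
    (parseClauses parseRefVar (parseNat (parseClauses parseNat (parseNat w).2).2).2).1).elim
      [false] fun u => true :: u

theorem analyze_encodeInput (n : ℕ) (φ : ClauseList (Fin n)) (s : ℕ)
    (π : ClauseList (RefVar n φ.length s)) :
    analyze (encodeInput n φ s π) =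
      (solve n (rawClauses Fin.val φ) s (rawClauses rawVar π)).elim [false] fun u => true :: u := by
  have h1 := parseClauses_encodeClauses (e := encodeVar (n := n)) (g := Fin.val)
    (fun v w => parseNat_encodeNat v w) φ
  have h2 := parseClauses_encodeClauses (parseRefVar_encodeRefVar (n := n) (m := φ.length) (s := s))
    π []
  rw [List.append_nil] at h2
  unfold analyze encodeInput
  simp only [List.append_assoc, parseNat_encodeNat, h1, h2]

namespace PolyTime

variable {α β γ : Type} [Code α] [Code β] [Code γ]

theorem parseList {p : List Bool → α × List Bool} (hp : PolyTime p) (hs : ∀ w, (p w).2 <:+ w) :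
    PolyTime (parseList p) := by
  have h1 : PolyTime fun q : List Bool × (List α × List Bool) × Bool => parseStep p q.2.1 := by
    have h := listCases (l := fun S : List α × List Bool => S.2) (f := fun S => S)
      (g := fun S b t => bif b then ((p t).1 :: S.1, (p t).2) else S) (by fun_prop) (by fun_prop)
      (by fun_prop)
    have h' : PolyTime (parseStep p) := by
      convert h using 2 with S
      unfold parseStep
      cases S.2 <;> rfl
    exact PolyTime.comp (f := parseStep p) h' (by fun_prop)
  have h2 : PolyTime fun w : List Bool =>
      w.foldl (fun S _ => parseStep p S) (([] : List α), w) := by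
    refine foldl (step := fun _ S _ => parseStep p S) (by fun_prop) (by fun_prop) h1 ?_
    obtain ⟨Q, hQ⟩ := hp.size_le
    refine ⟨Polynomial.X * (Q + 1) + 1 + Polynomial.X + 1, fun w l' hl' => ?_⟩
    have key : ∀ l : List Bool, (l.foldl (fun S _ => parseStep p S) (([] : List α), w)).1.length ≤
        l.length ∧ ∀ a ∈ (l.foldl (fun S _ => parseStep p S) (([] : List α), w)).1,
          size a ≤ Q.eval (size w) := by
      intro l
      induction l using List.reverseRecOn with
      | nil => simp
      | append_singleton l b ih =>
        rw [List.foldl_append, List.foldl_cons, List.foldl_nil]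
        have hsuf := foldl_parseStep_suffix hs l (([] : List α), w)
        generalize l.foldl (fun S _ => parseStep p S) (([] : List α), w) = S at ih hsuf
        obtain ⟨r, v⟩ := S
        cases v with
        | nil =>
          refine ⟨?_, ih.2⟩
          have := ih.1
          simp [parseStep] at this ⊢
          omega
        | cons c t =>
          cases c with
          | false =>
            refine ⟨?_, ih.2⟩
            have := ih.1
            simp [parseStep] at this ⊢
            omega
          | true =>
            have ht : size t ≤ size w :=
              size_le_of_sublist ((List.suffix_cons true t).trans hsuf).sublist
            have h3 : size (p t).1 ≤ Q.eval (size w) := by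
              have h4 := (hQ t).trans (eval_mono Q ht)
              have h5 : size (p t) = size (p t).1 + size (p t).2 + 1 := size_prod _ _
              omega
            simp only [parseStep, cond_true, List.length_cons, List.length_append,
              List.length_nil, List.mem_cons]
            refine ⟨by have := ih.1; simp at this; omega, fun a ha => ?_⟩
            rcases ha with rfl | ha
            · exact h3
            · exact ih.2 a ha
    have h3 := size_list_le (key l').2
    have h4 : size (l'.foldl (fun S _ => parseStep p S) (([] : List α), w)).2 ≤ size w :=
      size_le_of_sublist (foldl_parseStep_suffix hs l' _).sublist
    have h5 : (l'.foldl (fun S _ => parseStep p S) (([] : List α), w)).1.length ≤ size w :=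
      (key l').1.trans (hl'.length_le.trans (length_lt_size w).le)
    have h6 := Nat.mul_le_mul_right (Q.eval (size w) + 1) h5
    have h7 := size_prod (l'.foldl (fun S _ => parseStep p S) (([] : List α), w)).1
      (l'.foldl (fun S _ => parseStep p S) (([] : List α), w)).2
    rw [Prod.mk.eta] at h7
    simp only [Polynomial.eval_add, Polynomial.eval_mul, Polynomial.eval_X, Polynomial.eval_one]
    omega
  unfold ProofAnalysis.parseList
  fun_prop

theorem parseNat : PolyTime ProofAnalysis.parseNat := by
  have h := parseList (p := fun r => ((), r)) (by fun_prop) fun _ => List.suffix_refl _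
  unfold ProofAnalysis.parseNat
  generalize ProofAnalysis.parseList (fun r => ((), r)) = f at h
  fun_prop

theorem parseClauses {p : List Bool → α × List Bool} (hp : PolyTime p) (hs : ∀ w, (p w).2 <:+ w) :
    PolyTime (parseClauses p) := by
  have h : PolyTime (parseLit p) := by unfold parseLit; fun_prop
  exact parseList (parseList h (parseLit_suffix hs)) (parseList_suffix (parseLit_suffix hs))

theorem parseRefVar : PolyTime parseRefVar := by
  have h := parseNat
  unfold ProofAnalysis.parseRefVar parseIndices
  generalize ProofAnalysis.parseNat = f at h
  fun_prop

theorem analyze : PolyTime analyze := by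
  have h1 := parseClauses parseNat parseNat_suffix
  have h2 := parseClauses parseRefVar parseRefVar_suffix
  unfold ProofAnalysis.analyze
  generalize ProofAnalysis.parseClauses ProofAnalysis.parseNat = f at h1
  generalize ProofAnalysis.parseClauses ProofAnalysis.parseRefVar = g at h2
  have h3 := parseNat
  generalize ProofAnalysis.parseNat = k at h3
  fun_prop

end PolyTime

end ProofAnalysis

/-! ### Levels -/

namespace ProofAnalysis

theorem length_filter_range (p : ℕ → Bool) (N : ℕ) :
    ((List.range N).filter p).length = ((Finset.range N).filter fun k => p k = true).card := by
  rw [← List.toFinset_card_of_nodup (List.nodup_range.filter p)]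
  congr 1
  ext k
  simp

theorem lt_level_iff {n s B k : ℕ} (hk : k ≤ n) : k < level n s B ↔ 24 * n * k < s - 1 - B := by
  have key : ∀ N, (∀ k < N,
      (k < ((List.range N).filter fun k => decide (24 * n * k < s - 1 - B)).length ↔
        24 * n * k < s - 1 - B)) ∧
      ((List.range N).filter fun k => decide (24 * n * k < s - 1 - B)).length ≤ N := by
    intro N
    induction N with
    | zero => simp
    | succ N ih =>
      obtain ⟨ih1, ih2⟩ := ih
      rw [List.range_succ, List.filter_append, List.length_append]
      generalize ((List.range N).filter fun k => decide (24 * n * k < s - 1 - B)).length = c at *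
      by_cases h : 24 * n * N < s - 1 - B
      · have hc : c = N := by
          cases N with
          | zero => omega
          | succ N =>
            have := (ih1 N (by omega)).2 (lt_of_le_of_lt (Nat.mul_le_mul_left _ (by omega)) h)
            omega
        simp only [List.filter_cons, h, decide_true, if_true, List.filter_nil, List.length_singleton]
        refine ⟨fun k hk => ⟨fun _ => ?_, fun _ => by omega⟩, by omega⟩
        exact lt_of_le_of_lt (Nat.mul_le_mul_left _ (by omega)) h
      · simp only [List.filter_cons, h, decide_false, Bool.false_eq_true, if_false, List.filter_nil,
          List.length_nil, Nat.add_zero]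
        refine ⟨fun k hk => ?_, by omega⟩
        rcases Nat.lt_succ_iff_lt_or_eq.1 hk with hk | rfl
        · exact ih1 k hk
        · exact ⟨fun h' => by omega, fun h' => absurd h' h⟩
  exact (key (n + 1)).1 k (by omega)

theorem level_le (n s B : ℕ) : level n s B ≤ n + 1 := PolyTime.level_le n s B

theorem level_eq_zero_iff {n s B : ℕ} (hB : B < s) : level n s B = 0 ↔ B + 1 = s := by
  have := lt_level_iff (n := n) (s := s) (B := B) (k := 0) (by omega)
  omega

/-- Deeper levels consist of smaller blocks. -/
theorem lt_of_level_lt {n s B B' : ℕ} (h : level n s B < level n s B') : B' < B := by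
  by_contra hB
  have h1 := level_le n s B'
  have h2 := (lt_level_iff (n := n) (s := s) (B := B') (by omega)).1 h
  have h3 := (lt_level_iff (n := n) (s := s) (B := B) (k := level n s B) (by omega)).2 (by omega)
  omega

theorem card_level {n s k : ℕ} (hs : 24 * n * n < s) (hk1 : 1 ≤ k) (hk : k ≤ n) :
    ((Finset.range s).filter fun B => level n s B = k).card = 24 * n := by
  have e1 : 24 * n * k = 24 * n * (k - 1) + 24 * n := by
    obtain ⟨k, rfl⟩ := Nat.exists_eq_add_of_le' hk1
    simp [Nat.mul_add]
  have e2 : 24 * n * k ≤ 24 * n * n := Nat.mul_le_mul_left _ hk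
  have e : ((Finset.range s).filter fun B => level n s B = k) =
      Finset.Ico (s - 1 - 24 * n * k) (s - 1 - 24 * n * (k - 1)) := by
    ext B
    have h1 := lt_level_iff (n := n) (s := s) (B := B) (k := k) hk
    have h2 := lt_level_iff (n := n) (s := s) (B := B) (k := k - 1) (by omega)
    simp only [Finset.mem_filter, Finset.mem_range, Finset.mem_Ico]
    omega
  rw [e, Nat.card_Ico]
  omega

/-! ### The restriction -/

variable {n s : ℕ} {D : List (ℕ × Bool)}

theorem off_eq_none_iff {B : ℕ} : off n s D B = none ↔ level n s B ≤ n ∧ ∀ p ∈ D, p.1 ≠ B := by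
  unfold off
  by_cases h : n < level n s B
  · simp [h]
  · simp only [h, decide_false, cond_false, Option.map_eq_none_iff, List.find?_eq_none,
      decide_eq_true_eq]
    exact ⟨fun h' => ⟨by omega, h'⟩, fun h' => h'.2⟩

/-- What is needed of a restriction `D` in order to walk through the refutation `π`. -/
structure IsRestriction (n s : ℕ) (π : List RawClause) (D : List (ℕ × Bool)) : Prop where
  nodup : (D.map Prod.fst).Nodup
  level_pos : ∀ p ∈ D, 1 ≤ level n s p.1
  level_le : ∀ p ∈ D, level n s p.1 ≤ n
  count : ∀ k, (D.filter fun p => decide (level n s p.1 = k)).length ≤ 8 * n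
  narrow : ∀ E ∈ π, killed D E = false → ∀ k, (mentioned n s D k E).length ≤ 4 * n

/-- What holds for all restrictions that occur while the restriction is constructed greedily. The
last but one condition says that every disabled block of a level has reduced the number of wide
clauses at this level by a twelfth. -/
structure IsPartialRestriction (n s : ℕ) (π : List RawClause) (D : List (ℕ × Bool)) : Prop where
  nodup : (D.map Prod.fst).Nodup
  level_pos : ∀ p ∈ D, 1 ≤ level n s p.1
  level_le : ∀ p ∈ D, level n s p.1 ≤ n
  lt : ∀ p ∈ D, p.1 < s
  wide_le : ∀ k, 12 ^ (D.filter fun p => decide (level n s p.1 = k)).length *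
    (wide n s π D k).length ≤ 11 ^ (D.filter fun p => decide (level n s p.1 = k)).length * π.length
  count : ∀ k, (D.filter fun p => decide (level n s p.1 = k)).length ≤ 8 * n

theorem length_wide_cons_le (n s : ℕ) (π : List RawClause) (D : List (ℕ × Bool)) (p : ℕ × Bool)
    (k : ℕ) : (wide n s π (p :: D) k).length + ((wide n s π D k).filter (kills p)).length ≤
      (wide n s π D k).length := by
  have h1 : (wide n s π (p :: D) k).Sublist ((wide n s π D k).filter fun E => !kills p E) := by
    unfold wide
    rw [List.filter_filter]
    refine List.monotone_filter_right π fun E hE => ?_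
    simp only [killed, List.any_cons, Bool.and_eq_true, Bool.not_eq_true', Bool.or_eq_false_iff,
      decide_eq_true_eq] at hE ⊢
    refine ⟨hE.1.1, hE.1.2, hE.2.trans_le ?_⟩
    refine List.Sublist.length_le (List.monotone_filter_right _ fun B hB => ?_)
    simp only [Bool.and_eq_true, Option.isNone_iff_eq_none, off_eq_none_iff] at hB ⊢
    exact ⟨⟨hB.1.1, hB.1.2.1, fun q hq => hB.1.2.2 q (List.mem_cons_of_mem _ hq)⟩, hB.2⟩
  have h2 := h1.length_le
  have h3 := List.length_eq_length_filter_add (l := wide n s π D k) (kills p)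
  omega

/-- After `8 * n` rounds that each reduce fewer than `2 ^ n` clauses by a twelfth, none is left. -/
theorem eleven_pow_le {n t : ℕ} (h : 8 * n ≤ t) : 11 ^ t * 2 ^ n ≤ 12 ^ t := by
  obtain ⟨r, rfl⟩ := Nat.exists_eq_add_of_le h
  have h1 : (11 ^ 8 * 2) ^ n ≤ (12 ^ 8) ^ n := Nat.pow_le_pow_left (by norm_num) n
  have h2 : 11 ^ r ≤ 12 ^ r := Nat.pow_le_pow_left (by norm_num) r
  calc 11 ^ (8 * n + r) * 2 ^ n = (11 ^ 8 * 2) ^ n * 11 ^ r := by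
        rw [mul_pow, ← pow_mul, pow_add]; ring
    _ ≤ (12 ^ 8) ^ n * 12 ^ r := Nat.mul_le_mul h1 h2
    _ = 12 ^ (8 * n + r) := by rw [← pow_mul, pow_add]

theorem IsPartialRestriction.cons {π : List RawClause} (h : IsPartialRestriction n s π D)
    (hπ : π.length < 2 ^ n) {p : ℕ × Bool} (hps : p.1 < s) (hp : eligible n s π D p = true) :
    IsPartialRestriction n s π (p :: D) := by
  simp only [eligible, Bool.and_eq_true, decide_eq_true_eq, Option.isNone_iff_eq_none,
    off_eq_none_iff] at hp
  obtain ⟨⟨⟨h1, h2, h3⟩, h4⟩, h5⟩ := hp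
  have hcount : ∀ k, ((p :: D).filter fun p => decide (level n s p.1 = k)).length =
      (D.filter fun p => decide (level n s p.1 = k)).length + if level n s p.1 = k then 1 else 0 := by
    intro k
    by_cases hk : level n s p.1 = k <;> simp [hk]
  refine ⟨?_, ?_, ?_, ?_, fun k => ?_, fun k => ?_⟩
  · rw [List.map_cons, List.nodup_cons]
    refine ⟨fun hmem => ?_, h.nodup⟩
    obtain ⟨q, hq, e⟩ := List.mem_map.1 hmem
    exact h3 q hq e
  · exact List.forall_mem_cons.2 ⟨h1, h.level_pos⟩
  · exact List.forall_mem_cons.2 ⟨h2, h.level_le⟩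
  · exact List.forall_mem_cons.2 ⟨hps, h.lt⟩
  · rw [hcount]
    have h6 := length_wide_cons_le n s π D p k
    have h7 := h.wide_le k
    generalize (D.filter fun p => decide (level n s p.1 = k)).length = t at *
    split
    · next hk =>
      subst hk
      have h8 : 12 * (wide n s π (p :: D) (level n s p.1)).length ≤
        11 * (wide n s π D (level n s p.1)).length := by omega
      calc _ = 12 ^ t * (12 * (wide n s π (p :: D) (level n s p.1)).length) := by ring
        _ ≤ 12 ^ t * (11 * (wide n s π D (level n s p.1)).length) := Nat.mul_le_mul_left _ h8
        _ = 11 * (12 ^ t * (wide n s π D (level n s p.1)).length) := by ring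
        _ ≤ 11 * (11 ^ t * π.length) := Nat.mul_le_mul_left _ h7
        _ = _ := by ring
    · exact (Nat.mul_le_mul_left _ (by omega)).trans h7
  · rw [hcount]
    have h6 := h.count k
    split
    · next hk =>
      subst hk
      have h7 := h.wide_le (level n s p.1)
      generalize (D.filter fun q => decide (level n s q.1 = level n s p.1)).length = t at *
      by_contra hlt
      have h8 := eleven_pow_le (n := n) (t := t) (by omega)
      have h9 : 12 ^ t ≤ 11 ^ t * π.length := le_trans (Nat.le_mul_of_pos_right _ h4) h7
      have h10 : 11 ^ t * π.length < 11 ^ t * 2 ^ n := Nat.mul_lt_mul_of_pos_left hπ (by positivity)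
      omega
    · omega

theorem IsPartialRestriction.greedy_round {π : List RawClause} (hπ : π.length < 2 ^ n) (r : ℕ) :
    IsPartialRestriction n s π ((List.range r).foldl (fun D _ => greedyStep n s π D) []) ∧
    ((∀ p ∈ disablings s, eligible n s π
      ((List.range r).foldl (fun D _ => greedyStep n s π D) []) p = false) ∨
      ((List.range r).foldl (fun D _ => greedyStep n s π D) []).length = r) := by
  induction r with
  | zero =>
    refine ⟨⟨by simp, by simp, by simp, by simp, fun k => ?_, by simp⟩, Or.inr rfl⟩
    have : (wide n s π [] k).length ≤ π.length := List.length_filter_le _ _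
    simpa using this
  | succ r ih =>
    rw [List.range_succ, List.foldl_append]
    simp only [List.foldl_cons, List.foldl_nil]
    generalize (List.range r).foldl (fun D _ => greedyStep n s π D) [] = D at ih
    obtain ⟨h1, h2⟩ := ih
    unfold greedyStep
    cases hf : (disablings s).find? (eligible n s π D) with
    | none =>
      refine ⟨h1, Or.inl fun p hp => ?_⟩
      simpa using List.find?_eq_none.1 hf p hp
    | some p =>
      have h3 := List.mem_of_find?_eq_some hf
      have h4 := List.find?_some hf
      have h5 : p.1 < s := by
        simp [disablings] at h3
        rcases h3 with ⟨a, h, rfl⟩ | ⟨a, h, rfl⟩ <;> exact h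
      refine ⟨h1.cons hπ h5 h4, Or.inr ?_⟩
      rcases h2 with h2 | h2
      · rw [h2 p h3] at h4; cases h4
      · simp [h2]

theorem IsPartialRestriction.length_lt {π : List RawClause} (h : IsPartialRestriction n s π D)
    (hs : 1 ≤ s) : D.length < s := by
  have h1 : ((s - 1) :: D.map Prod.fst).Nodup := by
    rw [List.nodup_cons]
    refine ⟨fun hmem => ?_, h.nodup⟩
    obtain ⟨q, hq, e⟩ := List.mem_map.1 hmem
    have h2 := h.level_pos q hq
    have h3 := (level_eq_zero_iff (n := n) (s := s) (B := q.1) (by omega)).2 (by omega)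
    omega
  have h2 : ((s - 1) :: D.map Prod.fst) ⊆ List.range s := by
    intro B hB
    rw [List.mem_range]
    rcases List.mem_cons.1 hB with rfl | hB
    · omega
    · obtain ⟨q, hq, rfl⟩ := List.mem_map.1 hB
      exact h.lt q hq
  have h3 := (h1.subperm h2).length_le
  simp at h3
  omega

/-- Double counting: if each clause in `A` mentions more than `c` blocks in `P`, then some way to
disable a block in `P` kills many clauses. -/
theorem mul_length_le_sum_kills (A : List RawClause) (P : Finset ℕ) (c : ℕ)
    (h : ∀ E ∈ A, c ≤ (P.filter fun B => mentions E B = true).card) :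
    c * A.length ≤
      ∑ B ∈ P, ((A.filter (kills (B, false))).length + (A.filter (kills (B, true))).length) := by
  induction A with
  | nil => simp
  | cons E A ih =>
    have ih' := ih fun E hE => h E (List.mem_cons_of_mem _ hE)
    have h1 : (P.filter fun B => mentions E B = true).card ≤
        ∑ B ∈ P, ((if kills (B, false) E then 1 else 0) + (if kills (B, true) E then 1 else 0)) := by
      rw [Finset.card_filter]
      refine Finset.sum_le_sum fun B _ => ?_
      split
      · next hm =>
        simp only [mentions, List.any_eq_true, Bool.and_eq_true, Bool.not_eq_true',
          decide_eq_true_eq] at hm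
        obtain ⟨l, hl, h2, h3⟩ := hm
        have hk : kills (B, l.2) E = true := by
          simp only [kills, List.any_eq_true, Bool.and_eq_true, Bool.not_eq_true',
            decide_eq_true_eq]
          exact ⟨l, hl, ⟨h2, h3⟩, rfl⟩
        cases hb : l.2 <;> rw [hb] at hk <;> simp [hk]
      · omega
    have h2 := h E List.mem_cons_self
    have h3 : ∑ B ∈ P, (((E :: A).filter (kills (B, false))).length +
        ((E :: A).filter (kills (B, true))).length) =
        ∑ B ∈ P, ((if kills (B, false) E then 1 else 0) + (if kills (B, true) E then 1 else 0)) +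
        ∑ B ∈ P, ((A.filter (kills (B, false))).length + (A.filter (kills (B, true))).length) := by
      rw [← Finset.sum_add_distrib]
      refine Finset.sum_congr rfl fun B _ => ?_
      rw [List.filter_cons, List.filter_cons]
      split <;> split <;> simp <;> omega
    rw [h3, List.length_cons, Nat.mul_add]
    omega

theorem length_mentioned (k : ℕ) (E : RawClause) : (mentioned n s D k E).length =
    (((Finset.range s).filter fun B => level n s B = k ∧ off n s D B = none).filter
      fun B => mentions E B = true).card := by
  unfold mentioned
  rw [length_filter_range]
  congr 1
  ext B
  simp [and_assoc]

theorem isRestriction_greedy {π : List RawClause} (hn : 1 ≤ n) (hs : 24 * n * n < s)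
    (hπ : π.length < 2 ^ n) : IsRestriction n s π (greedy n s π) := by
  obtain ⟨h1, h2⟩ := IsPartialRestriction.greedy_round (s := s) hπ s
  have h3 := h1.length_lt (by omega)
  replace h2 := h2.resolve_right (by omega)
  change IsPartialRestriction n s π (greedy n s π) at h1
  change ∀ p ∈ disablings s, eligible n s π (greedy n s π) p = false at h2
  generalize greedy n s π = D at h1 h2
  refine ⟨h1.nodup, h1.level_pos, h1.level_le, h1.count, fun E hE hk k => ?_⟩
  by_contra hlt
  rw [not_le] at hlt
  have hle : (mentioned n s D k E).length ≤
      ((Finset.range s).filter fun B => level n s B = k ∧ off n s D B = none).card := by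
    rw [length_mentioned]
    exact Finset.card_filter_le _ _
  have hle2 : ((Finset.range s).filter fun B => level n s B = k ∧ off n s D B = none).card ≤
      ((Finset.range s).filter fun B => level n s B = k).card :=
    Finset.card_le_card fun B hB => by
      simp only [Finset.mem_filter] at hB ⊢
      exact ⟨hB.1, hB.2.1⟩
  -- The root is alone at its level, and the blocks below level `n` are disabled.
  have hk1 : 1 ≤ k := by
    by_contra hk0
    have hsub : ((Finset.range s).filter fun B => level n s B = k) ⊆ {s - 1} := by
      intro B hB
      simp only [Finset.mem_filter, Finset.mem_range, Finset.mem_singleton] at hB ⊢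
      have := (level_eq_zero_iff (n := n) hB.1).1 (by omega)
      omega
    have := Finset.card_le_card hsub
    rw [Finset.card_singleton] at this
    omega
  have hkn : k ≤ n := by
    by_contra hkn
    have hemp : ((Finset.range s).filter fun B => level n s B = k ∧ off n s D B = none) = ∅ := by
      refine Finset.filter_eq_empty_iff.2 fun B _ hB => ?_
      have := (off_eq_none_iff.1 hB.2).1
      omega
    rw [hemp, Finset.card_empty] at hle
    omega
  rw [card_level hs hk1 hkn] at hle2
  have hpos : 0 < (wide n s π D k).length := by
    refine List.length_pos_of_mem (a := E) ?_
    simp only [wide, List.mem_filter, Bool.and_eq_true, Bool.not_eq_true', decide_eq_true_eq]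
    exact ⟨hE, hk, hlt⟩
  have h4 := mul_length_le_sum_kills (wide n s π D k)
    ((Finset.range s).filter fun B => level n s B = k ∧ off n s D B = none) (4 * n + 1) (by
      intro E hE
      simp only [wide, List.mem_filter, Bool.and_eq_true, decide_eq_true_eq] at hE
      rw [← length_mentioned]
      exact hE.2.2)
  have h5 : ∀ B ∈ (Finset.range s).filter fun B => level n s B = k ∧ off n s D B = none,
      12 * (((wide n s π D k).filter (kills (B, false))).length +
        ((wide n s π D k).filter (kills (B, true))).length) ≤ 2 * (wide n s π D k).length := by
    intro B hB
    simp only [Finset.mem_filter, Finset.mem_range] at hB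
    obtain ⟨hB1, rfl, hB3⟩ := hB
    have h6 : ∀ b, 12 * ((wide n s π D (level n s B)).filter (kills (B, b))).length ≤
        (wide n s π D (level n s B)).length := by
      intro b
      have h7 := h2 (B, b) (by cases b <;> simpa [disablings] using hB1)
      simp only [eligible, hk1, decide_true, hB3, Option.isNone_none, hpos, Bool.true_and,
        decide_eq_false_iff_not] at h7
      omega
    have := h6 false
    have := h6 true
    omega
  have h6 := Finset.sum_le_card_nsmul _ _ _ h5
  rw [← Finset.mul_sum, smul_eq_mul] at h6
  have h7 := Nat.mul_le_mul_left 12 h4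
  have h8 := Nat.mul_le_mul_right (2 * (wide n s π D k).length) (hle2)
  have h9 : 12 * ((4 * n + 1) * (wide n s π D k).length) =
    24 * n * (2 * (wide n s π D k).length) + 12 * (wide n s π D k).length := by ring
  omega

end ProofAnalysis

/-! ### Records -/

namespace ProofAnalysis

variable {n s : ℕ} {φ : List RawCnfClause} {π : List RawClause} {D : List (ℕ × Bool)}
  {M M' : List Record}

theorem IsRestriction.off_eq_some (hD : IsRestriction n s π D) {p : ℕ × Bool} (hp : p ∈ D) :
    off n s D p.1 = some p.2 := by
  have h1 : ¬ n < level n s p.1 := by have := hD.level_le p hp; omega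
  unfold off
  simp only [h1, decide_false, cond_false]
  cases hf : D.find? fun q => decide (q.1 = p.1) with
  | none =>
    have := List.find?_eq_none.1 hf p hp
    simp at this
  | some q =>
    have h2 := List.mem_of_find?_eq_some hf
    have h3 : q.1 = p.1 := by simpa using List.find?_some hf
    rw [List.inj_on_of_nodup_map hD.nodup h2 hp h3]
    rfl

/-- The consistency conditions on a list of records. -/
structure IsConsistent (n s : ℕ) (D : List (ℕ × Bool)) (M : List Record) : Prop where
  unique : ∀ r ∈ M, ∀ r' ∈ M, r.1 = r'.1 → r = r'
  lt : ∀ r ∈ M, r.1 < s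
  enabled : ∀ r ∈ M, off n s D r.1 = none
  length_eq : ∀ r ∈ M, r.2.1.length = level n s r.1
  /-- The blocks from which a block was resolved are different enabled blocks at the next level. -/
  children : ∀ r ∈ M, level n s r.1 < n → r.2.2.1 ≠ r.2.2.2 ∧
    ∀ C, C = r.2.2.1 ∨ C = r.2.2.2 → C < s ∧ off n s D C = none ∧ level n s C = level n s r.1 + 1
  leaf : ∀ r ∈ M, level n s r.1 = n → r.2.2.1 = s ∧ r.2.2.2 = s
  left : ∀ r ∈ M, ∀ r' ∈ M, r.2.2.1 = r'.1 → r'.2.1 = r.2.1 ++ [false]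
  right : ∀ r ∈ M, ∀ r' ∈ M, r.2.2.2 = r'.1 → r'.2.1 = r.2.1 ++ [true]
  /-- No two blocks were resolved from the same block. -/
  apart : ∀ r ∈ M, ∀ r' ∈ M, ∀ C < s, (C = r.2.2.1 ∨ C = r.2.2.2) →
    (C = r'.2.2.1 ∨ C = r'.2.2.2) → r = r'

namespace IsConsistent

theorem nil : IsConsistent n s D [] := by
  constructor <;> simp

theorem mono (h : IsConsistent n s D M) (hM : M' ⊆ M) : IsConsistent n s D M' where
  unique r hr r' hr' := h.unique r (hM hr) r' (hM hr')
  lt r hr := h.lt r (hM hr)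
  enabled r hr := h.enabled r (hM hr)
  length_eq r hr := h.length_eq r (hM hr)
  children r hr := h.children r (hM hr)
  leaf r hr := h.leaf r (hM hr)
  left r hr r' hr' := h.left r (hM hr) r' (hM hr')
  right r hr r' hr' := h.right r (hM hr) r' (hM hr')
  apart r hr r' hr' := h.apart r (hM hr) r' (hM hr')

theorem level_le (h : IsConsistent n s D M) {r : Record} (hr : r ∈ M) : level n s r.1 ≤ n :=
  (off_eq_none_iff.1 (h.enabled r hr)).1

theorem find?_eq_some_iff (h : IsConsistent n s D M) {B : ℕ} {r : Record} :
    (M.find? fun r => decide (r.1 = B)) = some r ↔ r ∈ M ∧ r.1 = B := by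
  constructor
  · exact fun hf => ⟨List.mem_of_find?_eq_some hf, by simpa using List.find?_some hf⟩
  · rintro ⟨hr, rfl⟩
    cases hf : M.find? fun r' => decide (r'.1 = r.1) with
    | none =>
      have := List.find?_eq_none.1 hf r hr
      simp at this
    | some r' =>
      have h1 := List.mem_of_find?_eq_some hf
      have h2 : r'.1 = r.1 := by simpa using List.find?_some hf
      rw [h.unique r' h1 r hr h2]

theorem val_eq_some_iff (h : IsConsistent n s D M) {v : RawVar} {b : Bool}
    (hv : isEnable v = false) (ho : off n s D v.2.1 = none) :
    val n φ s D M v = some b ↔ ∃ r ∈ M, r.1 = v.2.1 ∧ recordVal n φ r v = b := by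
  simp only [val, hv, ho, cond_false, Option.elim_none, Option.map_eq_some_iff,
    h.find?_eq_some_iff, and_assoc]

end IsConsistent

theorem val_of_isEnable {v : RawVar} (hv : isEnable v = true) :
    val n φ s D M v = some (off n s D v.2.1).isNone := by
  simp [val, hv]

theorem val_of_off {v : RawVar} {b : Bool} (hv : isEnable v = false)
    (ho : off n s D v.2.1 = some b) : val n φ s D M v = some b := by
  simp [val, hv, ho]

theorem falsified_iff {E : RawClause} :
    falsified n φ s D M E = true ↔ ∀ l ∈ E, val n φ s D M l.1 = some (!l.2) := by
  simp only [falsified, List.all_eq_true, Bool.not_eq_true', decide_eq_false_iff_not]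
  refine forall₂_congr fun l _ => ?_
  cases val n φ s D M l.1 with
  | none => simp
  | some b => cases b <;> cases l.2 <;> simp

/-- A clause that is falsified by records remains so if records are added, or if only those of the
blocks mentioned in the clause are kept. -/
theorem falsified_of_forall_mem (hM : IsConsistent n s D M) (hM' : IsConsistent n s D M')
    {E : RawClause} (h : ∀ r ∈ M, mentions E r.1 = true → r ∈ M')
    (hE : falsified n φ s D M E = true) : falsified n φ s D M' E = true := by
  rw [falsified_iff] at hE ⊢
  intro l hl
  have h1 := hE l hl
  cases hv : isEnable l.1 with
  | true => rwa [val_of_isEnable hv] at h1 ⊢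
  | false =>
    cases ho : off n s D l.1.2.1 with
    | some b => rwa [val_of_off hv ho] at h1 ⊢
    | none =>
      rw [hM.val_eq_some_iff hv ho] at h1
      rw [hM'.val_eq_some_iff hv ho]
      obtain ⟨r, hr, h2, h3⟩ := h1
      refine ⟨r, h r hr ?_, h2, h3⟩
      simp only [mentions, List.any_eq_true, Bool.and_eq_true, Bool.not_eq_true',
        decide_eq_true_eq]
      exact ⟨l, hl, hv, h2.symm⟩

theorem IsRestriction.killed_eq_false (hD : IsRestriction n s π D) {E : RawClause}
    (hE : falsified n φ s D M E = true) : killed D E = false := by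
  rw [falsified_iff] at hE
  rw [Bool.eq_false_iff]
  intro hk
  simp only [killed, kills, List.any_eq_true, Bool.and_eq_true, Bool.not_eq_true',
    decide_eq_true_eq] at hk
  obtain ⟨p, hp, l, hl, ⟨hv, h1⟩, h2⟩ := hk
  have h3 := hE l hl
  have h4 := hD.off_eq_some hp
  rw [← h1] at h4
  rw [val_of_off hv h4, h2] at h3
  cases p.2 <;> simp at h3

/-- At each level, at most `4 * n` blocks have records. -/
def IsSmall (n s : ℕ) (M : List Record) : Prop :=
  ∀ k, (M.toFinset.filter fun r => level n s r.1 = k).card ≤ 4 * n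

theorem card_enabled (hD : IsRestriction n s π D) (hs : 24 * n * n < s) {k : ℕ} (hk1 : 1 ≤ k)
    (hk : k ≤ n) :
    16 * n ≤ ((Finset.range s).filter fun B => level n s B = k ∧ off n s D B = none).card := by
  have h1 : ((Finset.range s).filter fun B => level n s B = k) ⊆
      ((Finset.range s).filter fun B => level n s B = k ∧ off n s D B = none) ∪
      ((D.filter fun p => decide (level n s p.1 = k)).map Prod.fst).toFinset := by
    intro B hB
    simp only [Finset.mem_filter, Finset.mem_range, Finset.mem_union, List.mem_toFinset,
      List.mem_map, List.mem_filter, decide_eq_true_eq] at hB ⊢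
    by_cases ho : off n s D B = none
    · exact Or.inl ⟨hB.1, hB.2, ho⟩
    · refine Or.inr ?_
      rw [off_eq_none_iff] at ho
      push Not at ho
      obtain ⟨p, hp, rfl⟩ := ho (by omega)
      exact ⟨p, ⟨hp, hB.2⟩, rfl⟩
  have h2 := (Finset.card_le_card h1).trans (Finset.card_union_le _ _)
  have h3 := List.toFinset_card_le ((D.filter fun p => decide (level n s p.1 = k)).map Prod.fst)
  rw [List.length_map] at h3
  have h4 := hD.count k
  rw [card_level hs hk1 hk] at h2
  omega

/-- There are always two fresh blocks: of the at least `16 * n` enabled blocks at a level, at most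
`4 * n` have records, and at most `8 * n` are premises in records of the previous level. -/
theorem two_le_length_fresh (hD : IsRestriction n s π D) (hs : 24 * n * n < s)
    (hM : IsConsistent n s D M) (hM' : IsSmall n s M) {k : ℕ} (hk : k < n) :
    2 ≤ (fresh n s D M (k + 1)).length := by
  let X (k : ℕ) : Finset Record := M.toFinset.filter fun r => level n s r.1 = k
  have h1 : ((Finset.range s).filter fun B => level n s B = k + 1 ∧ off n s D B = none) ⊆
      ((Finset.range s).filter fun B => (decide (level n s B = k + 1) && (off n s D B).isNone &&
        !isUsed M B) = true) ∪
      ((X (k + 1)).image (fun r => r.1) ∪ ((X k).image (fun r => r.2.2.1) ∪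
        (X k).image fun r => r.2.2.2)) := by
    intro B hB
    simp only [Finset.mem_filter, Finset.mem_range] at hB
    by_cases hu : isUsed M B = true
    · refine Finset.mem_union_right _ ?_
      simp only [isUsed, List.any_eq_true, Bool.or_eq_true, decide_eq_true_eq] at hu
      obtain ⟨r, hr, hu⟩ := hu
      have hlev : r.1 ≠ B → level n s r.1 = k := by
        intro hne
        have h2 : B = r.2.2.1 ∨ B = r.2.2.2 := by
          rcases hu with (hu | hu) | hu
          · exact absurd hu hne
          · exact Or.inl hu.symm
          · exact Or.inr hu.symm
        by_cases h3 : level n s r.1 < n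
        · have := ((hM.children r hr h3).2 B h2).2.2
          omega
        · have h4 := hM.level_le hr
          have h5 := hM.leaf r hr (by omega)
          rcases h2 with h2 | h2 <;> omega
      simp only [Finset.mem_union, Finset.mem_image, X, Finset.mem_filter, List.mem_toFinset]
      by_cases hne : r.1 = B
      · exact Or.inl ⟨r, ⟨hr, hne ▸ hB.2.1⟩, hne⟩
      · rcases hu with (hu | hu) | hu
        · exact absurd hu hne
        · exact Or.inr (Or.inl ⟨r, ⟨hr, hlev hne⟩, hu⟩)
        · exact Or.inr (Or.inr ⟨r, ⟨hr, hlev hne⟩, hu⟩)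
    · refine Finset.mem_union_left _ ?_
      simp only [Finset.mem_filter, Finset.mem_range]
      refine ⟨hB.1, ?_⟩
      simp [hB.2.1, hB.2.2, hu]
  have h2 := Finset.card_le_card h1
  have h3 := Finset.card_union_le ((Finset.range s).filter fun B =>
    (decide (level n s B = k + 1) && (off n s D B).isNone && !isUsed M B) = true)
    ((X (k + 1)).image (fun r => r.1) ∪ ((X k).image (fun r => r.2.2.1) ∪
        (X k).image fun r => r.2.2.2))
  have h4 := Finset.card_union_le ((X (k + 1)).image (fun r => r.1))
    ((X k).image (fun r => r.2.2.1) ∪ (X k).image fun r => r.2.2.2)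
  have h5 := Finset.card_union_le ((X k).image (fun r => r.2.2.1)) ((X k).image fun r => r.2.2.2)
  have h6 := Finset.card_image_le (s := X (k + 1)) (f := fun r => r.1)
  have h7 := Finset.card_image_le (s := X k) (f := fun r => r.2.2.1)
  have h8 := Finset.card_image_le (s := X k) (f := fun r => r.2.2.2)
  have h9 := hM' (k + 1)
  have h10 := hM' k
  have h11 := card_enabled hD hs (k := k + 1) (by omega) (by omega)
  unfold fresh
  rw [length_filter_range]
  change (X (k + 1)).card ≤ _ at h9
  change (X k).card ≤ _ at h10
  omega

theorem mem_fresh {k C : ℕ} : C ∈ fresh n s D M k ↔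
    C < s ∧ level n s C = k ∧ off n s D C = none ∧ isUsed M C = false := by
  simp [fresh, and_assoc]

theorem not_mem_of_isUsed_eq_false {C : ℕ} (h : isUsed M C = false) {r : Record} (hr : r ∈ M) :
    r.1 ≠ C ∧ r.2.2.1 ≠ C ∧ r.2.2.2 ≠ C := by
  simp only [isUsed, List.any_eq_false, Bool.or_eq_true, decide_eq_true_eq, not_or] at h
  have := h r hr
  tauto

/-- The two blocks in a new record below level `n` are fresh. -/
theorem newRecord_children (hD : IsRestriction n s π D) (hs : 24 * n * n < s)
    (hM : IsConsistent n s D M) (hM' : IsSmall n s M) {B : ℕ} (hB : level n s B < n) :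
    (newRecord n s D M B).2.2.1 ≠ (newRecord n s D M B).2.2.2 ∧
    ∀ C, C = (newRecord n s D M B).2.2.1 ∨ C = (newRecord n s D M B).2.2.2 →
      C ∈ fresh n s D M (level n s B + 1) := by
  have h := two_le_length_fresh hD hs hM hM' hB
  have hnd : (fresh n s D M (level n s B + 1)).Nodup := List.nodup_range.filter _
  unfold newRecord
  generalize fresh n s D M (level n s B + 1) = F at *
  match F, h with
  | a :: b :: F, _ =>
    simp only [List.nodup_cons, List.mem_cons, not_or] at hnd
    simp only [List.getElem?_cons_zero, List.getElem?_cons_succ, Option.getD_some]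
    refine ⟨hnd.1.1, ?_⟩
    rintro C (rfl | rfl) <;> simp

theorem newRecord_leaf {B : ℕ} (hB : level n s B = n) :
    (newRecord n s D M B).2.2.1 = s ∧ (newRecord n s D M B).2.2.2 = s := by
  have h : fresh n s D M (level n s B + 1) = [] := by
    rw [List.eq_nil_iff_forall_not_mem]
    intro C hC
    rw [mem_fresh] at hC
    have := (off_eq_none_iff.1 hC.2.2.1).1
    omega
  unfold newRecord
  rw [h]
  exact ⟨rfl, rfl⟩

/-- The assignment in a new record agrees with the record of a block that was resolved from its
block. -/
theorem newRecord_label (hM : IsConsistent n s D M) {r : Record} (hr : r ∈ M) {B : ℕ} (hB : B < s)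
    (h : B = r.2.2.1 ∨ B = r.2.2.2) :
    (newRecord n s D M B).2.1 = r.2.1 ++ [decide (r.2.2.2 = B)] := by
  have h1 : level n s r.1 < n := by
    by_contra h1
    have h2 := hM.level_le hr
    have h3 := hM.leaf r hr (by omega)
    omega
  have h2 := ((hM.children r hr h1).2 B h).2.2
  have h3 : inherited M B = r.2.1 ++ [decide (r.2.2.2 = B)] := by
    unfold inherited
    cases hf : M.find? fun r => decide (r.2.2.1 = B) || decide (r.2.2.2 = B) with
    | none =>
      have := List.find?_eq_none.1 hf r hr
      simp at this
      omega
    | some r' =>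
      have h4 := List.mem_of_find?_eq_some hf
      have h5 := List.find?_some hf
      simp only [Bool.or_eq_true, decide_eq_true_eq] at h5
      rw [hM.apart r' h4 r hr B hB (by tauto) h]
      rfl
  simp only [newRecord, h3]
  have h4 : (r.2.1 ++ [decide (r.2.2.2 = B)]).length = level n s B := by
    rw [List.length_append, hM.length_eq r hr, h2]; rfl
  refine List.ext_getElem (by simpa using h4.symm) fun j h5 h6 => ?_
  rw [List.getElem_map, List.getElem_range, List.getElem?_eq_getElem h6, Option.getD_some]

theorem subset_query (B : ℕ) : M ⊆ query n s D M B := by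
  unfold query
  cases (off n s D B).isNone && (M.find? fun r => decide (r.1 = B)).isNone
  · exact fun _ h => h
  · exact List.subset_cons_self _ _

theorem exists_mem_query {B : ℕ} (hB : off n s D B = none) :
    ∃ r ∈ query n s D M B, r.1 = B := by
  unfold query
  cases hf : M.find? fun r => decide (r.1 = B) with
  | none => exact ⟨newRecord n s D M B, by simp [hB], rfl⟩
  | some r => exact ⟨r, by simpa using List.mem_of_find?_eq_some hf, by simpa using List.find?_some hf⟩

theorem IsConsistent.query (hD : IsRestriction n s π D) (hs : 24 * n * n < s)
    (hM : IsConsistent n s D M) (hM' : IsSmall n s M) {B : ℕ} (hB : B < s) :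
    IsConsistent n s D (query n s D M B) := by
  unfold ProofAnalysis.query
  cases hc : (off n s D B).isNone && (M.find? fun r => decide (r.1 = B)).isNone
  · exact hM
  simp only [Bool.and_eq_true, Option.isNone_iff_eq_none, List.find?_eq_none,
    decide_eq_true_eq] at hc
  obtain ⟨ho, hnew⟩ := hc
  have hle := (off_eq_none_iff.1 ho).1
  have hN1 : (newRecord n s D M B).1 = B := rfl
  have hlen : (newRecord n s D M B).2.1.length = level n s B := by simp [newRecord]
  have hch := newRecord_children hD hs hM hM' (B := B)
  have hlf := newRecord_leaf (D := D) (M := M) (B := B) (n := n) (s := s)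
  have hlab := fun r hr => newRecord_label hM (r := r) hr hB
  generalize newRecord n s D M B = N at *
  subst hN1
  -- The blocks in the new record are fresh, except for the dummy value.
  have hC : ∀ C, C = N.2.2.1 ∨ C = N.2.2.2 →
      C = s ∧ level n s N.1 = n ∨ C ∈ fresh n s D M (level n s N.1 + 1) := by
    intro C hC
    by_cases h : level n s N.1 < n
    · exact Or.inr ((hch h).2 C hC)
    · have := hlf (by omega)
      exact Or.inl ⟨by omega, by omega⟩
  have hself : ∀ C, C = N.2.2.1 ∨ C = N.2.2.2 → C ≠ N.1 := by
    rintro C h rfl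
    rcases hC _ h with h | h
    · omega
    · have := (mem_fresh.1 h).2.1
      omega
  have hother : ∀ C, C = N.2.2.1 ∨ C = N.2.2.2 → ∀ r ∈ M, C ≠ r.1 := by
    rintro C h r hr rfl
    have := hM.lt r hr
    rcases hC _ h with h | h
    · omega
    · exact (not_mem_of_isUsed_eq_false (mem_fresh.1 h).2.2.2 hr).1 rfl
  have hapart : ∀ r ∈ M, ∀ C < s, (C = N.2.2.1 ∨ C = N.2.2.2) → ¬ (C = r.2.2.1 ∨ C = r.2.2.2) := by
    intro r hr C hCs h h'
    rcases hC _ h with h | h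
    · omega
    · have := not_mem_of_isUsed_eq_false (mem_fresh.1 h).2.2.2 hr
      omega
  -- A record that leads to the new one is not a leaf.
  have hlr : ∀ r ∈ M, N.1 = r.2.2.1 ∨ N.1 = r.2.2.2 → r.2.2.1 ≠ r.2.2.2 := by
    intro r hr h
    by_cases h1 : level n s r.1 < n
    · exact (hM.children r hr h1).1
    · have := hM.leaf r hr (by have := hM.level_le hr; omega)
      omega
  simp only [cond_true]
  constructor
  · rintro r hr r' hr' e
    rcases List.mem_cons.1 hr with rfl | h₁ <;> rcases List.mem_cons.1 hr' with rfl | h₂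
    · rfl
    · exact absurd e.symm (hnew r' h₂)
    · exact absurd e (hnew r h₁)
    · exact hM.unique r h₁ r' h₂ e
  · exact List.forall_mem_cons.2 ⟨hB, hM.lt⟩
  · exact List.forall_mem_cons.2 ⟨ho, hM.enabled⟩
  · exact List.forall_mem_cons.2 ⟨hlen, hM.length_eq⟩
  · refine List.forall_mem_cons.2 ⟨fun h => ⟨(hch h).1, fun C hC => ?_⟩, hM.children⟩
    have := mem_fresh.1 ((hch h).2 C hC)
    exact ⟨this.1, this.2.2.1, this.2.1⟩
  · exact List.forall_mem_cons.2 ⟨hlf, hM.leaf⟩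
  · rintro r hr r' hr' e
    rcases List.mem_cons.1 hr with rfl | h₁ <;> rcases List.mem_cons.1 hr' with rfl | h₂
    · exact absurd e (hself _ (Or.inl rfl))
    · exact absurd e (hother _ (Or.inl rfl) r' h₂)
    · rw [hlab r h₁ (Or.inl e.symm), decide_eq_false]
      have := hlr r h₁ (Or.inl e.symm)
      omega
    · exact hM.left r h₁ r' h₂ e
  · rintro r hr r' hr' e
    rcases List.mem_cons.1 hr with rfl | h₁ <;> rcases List.mem_cons.1 hr' with rfl | h₂
    · exact absurd e (hself _ (Or.inr rfl))
    · exact absurd e (hother _ (Or.inr rfl) r' h₂)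
    · rw [hlab r h₁ (Or.inr e.symm), decide_eq_true e]
    · exact hM.right r h₁ r' h₂ e
  · rintro r hr r' hr' C hCs h h'
    rcases List.mem_cons.1 hr with rfl | h₁ <;> rcases List.mem_cons.1 hr' with rfl | h₂
    · rfl
    · exact absurd h' (hapart r' h₂ C hCs h)
    · exact absurd h (hapart r h₁ C hCs h')
    · exact hM.apart r h₁ r' h₂ C hCs h h'

/-- The invariant of the walk is preserved by moving to a falsified clause. -/
theorem isSmall_of_falsified (hD : IsRestriction n s π D) (hM : IsConsistent n s D M)
    {E : RawClause} (hEπ : E ∈ π) (hE : falsified n φ s D M E = true)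
    (h : ∀ r ∈ M, mentions E r.1 = true) : IsSmall n s M := by
  intro k
  refine le_trans ?_ (hD.narrow E hEπ (hD.killed_eq_false hE) k)
  have h1 : (mentioned n s D k E).Nodup := List.nodup_range.filter _
  rw [← List.toFinset_card_of_nodup h1]
  refine Finset.card_le_card_of_injOn Prod.fst ?_ ?_
  · intro r hr
    simp only [Finset.coe_filter, List.mem_toFinset, Set.mem_ofPred_eq] at hr
    simp [mentioned, hM.lt r hr.1, hr.2, hM.enabled r hr.1, h r hr.1]
  · intro r hr r' hr' e
    simp only [Finset.coe_filter, List.mem_toFinset, Set.mem_ofPred_eq] at hr hr'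
    exact hM.unique r hr.1 r' hr'.1 e

theorem walkStep_cases (hD : IsRestriction n s π D) (hs : 24 * n * n < s)
    (hM : IsConsistent n s D M) (hM' : IsSmall n s M) {E : RawClause} (hE : E ∈ π) :
    (walkStep n φ s D M E = M ∧ ∀ B < s, falsified n φ s D (query n s D M B) E = false) ∨
    (IsConsistent n s D (walkStep n φ s D M E) ∧ IsSmall n s (walkStep n φ s D M E) ∧
      falsified n φ s D (walkStep n φ s D M E) E = true) := by
  unfold walkStep
  cases hf : (List.range s).find? fun B => falsified n φ s D (query n s D M B) E with
  | none =>
    refine Or.inl ⟨rfl, fun B hB => ?_⟩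
    simpa using List.find?_eq_none.1 hf B (by simpa using hB)
  | some B =>
    have hB : B < s := by simpa using List.mem_of_find?_eq_some hf
    have h1 := hM.query hD hs hM' hB
    have h2 : falsified n φ s D (query n s D M B) E = true := by simpa using List.find?_some hf
    simp only [Option.elim_some]
    have h3 := h1.mono (M' := (query n s D M B).filter fun r => mentions E r.1)
      fun r hr => (List.mem_filter.1 hr).1
    have h4 := falsified_of_forall_mem (E := E) h1 h3 (fun r hr hm => by simp [hr, hm]) h2
    exact Or.inr ⟨h3, isSmall_of_falsified hD h3 hE h4 fun r hr => (List.mem_filter.1 hr).2, h4⟩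

end ProofAnalysis

/-! ### The end of the walk -/

namespace ProofAnalysis

variable {n s : ℕ} {π : List RawClause} {D : List (ℕ × Bool)} {M : List Record}

theorem eq_of_falsifiesLit_append {u : List Bool} {c : Bool} {l : ℕ × Bool}
    (h : falsifiesLit (u ++ [c]) l = true) (h' : falsifiesLit u l = false) :
    l = (u.length, !c) := by
  obtain ⟨j, b⟩ := l
  simp only [falsifiesLit, Bool.not_eq_true', decide_eq_false_iff_not, Bool.not_eq_false',
    decide_eq_true_eq] at h h'
  rcases lt_trichotomy j u.length with hj | rfl | hj
  · rw [List.getElem?_append_left hj] at h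
    exact absurd h' h
  · rw [List.getElem?_concat_length] at h
    cases b <;> cases c <;> simp_all
  · rw [List.getElem?_eq_none (by simp; omega)] at h
    exact absurd rfl h

theorem off_root (hD : IsRestriction n s π D) {B : ℕ} (hB : B + 1 = s) :
    level n s B = 0 ∧ off n s D B = none := by
  have h := (level_eq_zero_iff (n := n) (s := s) (B := B) (by omega)).2 hB
  refine ⟨h, off_eq_none_iff.2 ⟨by omega, ?_⟩⟩
  rintro p hp rfl
  have := hD.level_pos p hp
  omega

/-- The records falsify no clause of `Ref_s(φ)`, except for one which says that a block without
premises is a weakening of a clause of `φ`. Then the assignment of the block is total, and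
falsifies no clause of `φ`. -/
theorem exists_satisfies_of_refClause (hD : IsRestriction n s π D) (hM : IsConsistent n s D M)
    {φ : ClauseList (Fin n)} {C : Clause (RefVar n φ.length s)} (hC : RefClause s φ.toCNF C)
    (h : ∀ l ∈ C, val n (rawClauses Fin.val φ) s D M (rawVar l.1) = some (!l.2)) :
    ∃ r ∈ M, r.2.1.length = n ∧ satisfies (rawClauses Fin.val φ) r.2.1 = true := by
  have hen : ∀ {B : Fin s} {b : Bool}, val n (rawClauses Fin.val φ) s D M
      (rawVar (RefVar.enable B : RefVar n φ.length s)) = some b → (off n s D B).isNone = b := by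
    intro B b hb
    rw [val_of_isEnable (by rfl)] at hb
    simpa [rawVar] using hb
  have hrec : ∀ {v : RefVar n φ.length s} {b : Bool},
      val n (rawClauses Fin.val φ) s D M (rawVar v) = some b → isEnable (rawVar v) = false →
      off n s D (rawVar v).2.1 = none →
      ∃ r ∈ M, r.1 = (rawVar v).2.1 ∧ recordVal n (rawClauses Fin.val φ) r (rawVar v) = b :=
    fun h1 h2 h3 => (hM.val_eq_some_iff h2 h3).1 h1
  have hval : ∀ {v : RefVar n φ.length s} {b : Bool} {r : Record},
      val n (rawClauses Fin.val φ) s D M (rawVar v) = some b → isEnable (rawVar v) = false →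
      r ∈ M → r.1 = (rawVar v).2.1 → recordVal n (rawClauses Fin.val φ) r (rawVar v) = b := by
    intro v b r h1 h2 hr h3
    obtain ⟨r', hr', h4, h5⟩ := hrec h1 h2 (h3 ▸ hM.enabled r hr)
    rwa [hM.unique r hr r' hr' (h3.trans h4.symm)]
  cases hC with
  | left_lit B B' hlt i l hl =>
    simp only [Finset.mem_insert, Finset.mem_singleton, forall_eq_or_imp, forall_eq,
      Bool.not_false, Bool.not_true] at h
    obtain ⟨h1, h2, h3, h4, h5⟩ := h
    obtain ⟨r, hr, hrB, h6⟩ := hrec h2 rfl (Option.isNone_iff_eq_none.1 (hen h1))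
    replace h6 : (i : ℕ) = r.2.1.length := of_decide_eq_true h6
    have h7 := of_decide_eq_true (hval h3 rfl hr hrB)
    have h8 := hval h5 rfl hr hrB
    simp only [rawVar] at h7
    simp only [recordVal, rawVar, cond_true, cond_false] at h8
    have h9 := hM.length_eq r hr
    obtain ⟨r', hr', h10, h11⟩ := hrec h4 rfl
      ((hM.children r hr (by omega)).2 _ (Or.inl h7)).2.1
    simp only [recordVal, rawVar, cond_true, cond_false] at h10 h11
    rw [hM.left r hr r' hr' (h7.symm.trans h10.symm)] at h11
    have h12 := eq_of_falsifiesLit_append h11 h8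
    simp only [Prod.mk.injEq, Bool.not_false] at h12
    exact absurd (Prod.ext (Fin.ext (h12.1.trans h6.symm)) h12.2) hl
  | right_lit B B' hlt i l hl =>
    simp only [Finset.mem_insert, Finset.mem_singleton, forall_eq_or_imp, forall_eq,
      Bool.not_false, Bool.not_true] at h
    obtain ⟨h1, h2, h3, h4, h5⟩ := h
    obtain ⟨r, hr, hrB, h6⟩ := hrec h2 rfl (Option.isNone_iff_eq_none.1 (hen h1))
    replace h6 : (i : ℕ) = r.2.1.length := of_decide_eq_true h6
    have h7 := of_decide_eq_true (hval h3 rfl hr hrB)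
    have h8 := hval h5 rfl hr hrB
    simp only [rawVar] at h7
    simp only [recordVal, rawVar, cond_true, cond_false] at h8
    have h9 := hM.length_eq r hr
    obtain ⟨r', hr', h10, h11⟩ := hrec h4 rfl
      ((hM.children r hr (by omega)).2 _ (Or.inr h7)).2.1
    simp only [recordVal, rawVar, cond_true, cond_false] at h10 h11
    rw [hM.right r hr r' hr' (h7.symm.trans h10.symm)] at h11
    have h12 := eq_of_falsifiesLit_append h11 h8
    simp only [Prod.mk.injEq, Bool.not_true] at h12
    exact absurd (Prod.ext (Fin.ext (h12.1.trans h6.symm)) h12.2) hl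
  | weak_lit B A l hl =>
    simp only [Finset.mem_insert, Finset.mem_singleton, forall_eq_or_imp, forall_eq,
      Bool.not_false, Bool.not_true] at h
    obtain ⟨h1, h2, h3⟩ := h
    obtain ⟨r, hr, hrB, h4⟩ := hrec h2 rfl (Option.isNone_iff_eq_none.1 (hen h1))
    have h5 := hval h3 rfl hr hrB
    simp only [recordVal, rawVar, cond_true, cond_false, rawClauses, List.getElem?_map,
      List.getElem?_eq_getElem A.2, Option.map_some, Option.getD_some, List.all_eq_true,
      List.forall_mem_map] at h4 h5
    rw [h4 l (by simpa [ClauseList.toCNF] using hl)] at h5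
    cases h5
  | must_resolve B =>
    simp only [Finset.mem_union, Finset.mem_insert, Finset.mem_singleton, Finset.mem_image,
      Finset.mem_univ, true_and] at h
    have h1 := h _ (Or.inl (Or.inl rfl))
    obtain ⟨r, hr, hrB, h2⟩ := hrec (h _ (Or.inl (Or.inr rfl))) rfl
      (Option.isNone_iff_eq_none.1 (hen h1))
    simp only [recordVal, rawVar, cond_false, Bool.not_false, decide_eq_true_eq] at h2
    have h3 := hval (h _ (Or.inr ⟨⟨_, h2⟩, rfl⟩)) rfl hr hrB
    simp [recordVal, rawVar] at h3
  | must_point_left B =>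
    simp only [Finset.mem_union, Finset.mem_insert, Finset.mem_singleton, Finset.mem_image,
      Finset.mem_univ, true_and] at h
    have h1 := h _ (Or.inl (Or.inl rfl))
    obtain ⟨r, hr, hrB, h2⟩ := hrec (h _ (Or.inl (Or.inr rfl))) rfl
      (Option.isNone_iff_eq_none.1 (hen h1))
    simp only [recordVal, rawVar, cond_false, Bool.not_false, decide_eq_true_eq] at h2 hrB
    rw [hM.length_eq r hr] at h2
    obtain ⟨h3, -, h4⟩ := (hM.children r hr h2).2 _ (Or.inl rfl)
    have h5 : r.2.2.1 < B := hrB ▸ lt_of_level_lt (n := n) (s := s) (by omega)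
    have h6 := hval (h _ (Or.inr ⟨⟨⟨_, h3⟩, h5⟩, rfl⟩)) rfl hr hrB
    simp [recordVal, rawVar] at h6
  | must_point_right B =>
    simp only [Finset.mem_union, Finset.mem_insert, Finset.mem_singleton, Finset.mem_image,
      Finset.mem_univ, true_and] at h
    have h1 := h _ (Or.inl (Or.inl rfl))
    obtain ⟨r, hr, hrB, h2⟩ := hrec (h _ (Or.inl (Or.inr rfl))) rfl
      (Option.isNone_iff_eq_none.1 (hen h1))
    simp only [recordVal, rawVar, cond_false, Bool.not_false, decide_eq_true_eq] at h2 hrB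
    rw [hM.length_eq r hr] at h2
    obtain ⟨h3, -, h4⟩ := (hM.children r hr h2).2 _ (Or.inr rfl)
    have h5 : r.2.2.2 < B := hrB ▸ lt_of_level_lt (n := n) (s := s) (by omega)
    have h6 := hval (h _ (Or.inr ⟨⟨⟨_, h3⟩, h5⟩, rfl⟩)) rfl hr hrB
    simp [recordVal, rawVar] at h6
  | must_weaken B =>
    simp only [Finset.mem_union, Finset.mem_insert, Finset.mem_singleton, Finset.mem_image,
      Finset.mem_univ, true_and] at h
    have h1 := h _ (Or.inl (Or.inl rfl))
    obtain ⟨r, hr, hrB, h2⟩ := hrec (h _ (Or.inl (Or.inr rfl))) rfl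
      (Option.isNone_iff_eq_none.1 (hen h1))
    simp only [recordVal, rawVar, cond_false, Bool.not_true, decide_eq_false_iff_not] at h2
    have h3 := hM.level_le hr
    have h4 := hM.length_eq r hr
    have h5 : r.2.1.length = n := by omega
    refine ⟨r, hr, h5, ?_⟩
    simp only [satisfies, rawClauses, List.all_eq_true, List.forall_mem_map]
    intro E hE
    obtain ⟨A, hA, rfl⟩ := List.getElem_of_mem hE
    have h6 := hval (h _ (Or.inr ⟨⟨A, hA⟩, rfl⟩)) rfl hr hrB
    simp only [recordVal, rawVar, cond_true, cond_false, rawClauses, List.getElem?_map,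
      List.getElem?_eq_getElem hA, Option.map_some, Option.getD_some, Bool.not_true,
      List.all_eq_false, List.mem_map] at h6
    obtain ⟨_, ⟨l, hl, rfl⟩, h7⟩ := h6
    simp only [List.any_eq_true, List.mem_map]
    refine ⟨_, ⟨l, hl, rfl⟩, ?_⟩
    simpa [falsifiesLit, h5] using h7
  | enable_left B B' hlt =>
    simp only [Finset.mem_insert, Finset.mem_singleton, forall_eq_or_imp, forall_eq,
      Bool.not_false, Bool.not_true] at h
    obtain ⟨h1, h2, h3⟩ := h
    obtain ⟨r, hr, hrB, h4⟩ := hrec h2 rfl (Option.isNone_iff_eq_none.1 (hen h1))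
    replace h4 := of_decide_eq_true h4
    simp only [rawVar] at h4
    have h5 := hen h3
    by_cases h6 : level n s r.1 < n
    · rw [((hM.children r hr h6).2 _ (Or.inl h4)).2.1] at h5
      cases h5
    · have h7 := hM.level_le hr
      have h8 := hM.leaf r hr (by omega)
      have h9 := B'.2
      omega
  | enable_right B B' hlt =>
    simp only [Finset.mem_insert, Finset.mem_singleton, forall_eq_or_imp, forall_eq,
      Bool.not_false, Bool.not_true] at h
    obtain ⟨h1, h2, h3⟩ := h
    obtain ⟨r, hr, hrB, h4⟩ := hrec h2 rfl (Option.isNone_iff_eq_none.1 (hen h1))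
    replace h4 := of_decide_eq_true h4
    simp only [rawVar] at h4
    have h5 := hen h3
    by_cases h6 : level n s r.1 < n
    · rw [((hM.children r hr h6).2 _ (Or.inr h4)).2.1] at h5
      cases h5
    · have h7 := hM.level_le hr
      have h8 := hM.leaf r hr (by omega)
      have h9 := B'.2
      omega
  | root_empty B hB l =>
    obtain ⟨h1, h2⟩ := off_root hD hB
    obtain ⟨r, hr, hrB, h3⟩ := hrec (h _ (Finset.mem_singleton_self _)) rfl h2
    have h4 := hM.length_eq r hr
    simp only [rawVar] at hrB
    rw [hrB, h1, List.length_eq_zero_iff] at h4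
    simp [recordVal, rawVar, h4, falsifiesLit] at h3
  | root_enabled B hB =>
    have h1 := hen (h _ (Finset.mem_singleton_self _))
    rw [(off_root hD hB).2] at h1
    cases h1

/-- The walk ends at a falsified clause `E`, such that no single query falsifies an earlier clause. -/
theorem walk_spec {φ : List RawCnfClause} (hD : IsRestriction n s π D) (hs : 24 * n * n < s)
    {L : List RawClause} (hL : L ⊆ π) (hlast : L.getLast? = some []) :
    IsConsistent n s D (walk n φ s D L) ∧ IsSmall n s (walk n φ s D L) ∧
    ∃ L₁ E L₂, L = L₁ ++ E :: L₂ ∧ falsified n φ s D (walk n φ s D L) E = true ∧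
      ∀ E' ∈ L₁, ∀ B < s, falsified n φ s D (query n s D (walk n φ s D L) B) E' = false := by
  induction L with
  | nil => simp at hlast
  | cons E L ih =>
    change IsConsistent n s D (walkStep n φ s D (walk n φ s D L) E) ∧
      IsSmall n s (walkStep n φ s D (walk n φ s D L) E) ∧
      ∃ L₁ F L₂, E :: L = L₁ ++ F :: L₂ ∧
        falsified n φ s D (walkStep n φ s D (walk n φ s D L) E) F = true ∧
        ∀ E' ∈ L₁, ∀ B < s,
          falsified n φ s D (query n s D (walkStep n φ s D (walk n φ s D L) E) B) E' = false
    have hE : E ∈ π := hL List.mem_cons_self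
    by_cases hnil : L = []
    · subst hnil
      obtain rfl : E = [] := by simpa using hlast
      have h := walkStep_cases (φ := φ) hD hs IsConsistent.nil
        (fun k => by simp : IsSmall n s []) hE
      rcases h with ⟨-, h⟩ | ⟨h1, h2, h3⟩
      · cases h 0 (by omega)
      · exact ⟨h1, h2, [], [], [], rfl, h3, by simp⟩
    · have hlast' : L.getLast? = some [] := by
        obtain ⟨a, L, rfl⟩ := List.exists_cons_of_ne_nil hnil
        simpa using hlast
      obtain ⟨hM, hM', L₁, F, L₂, rfl, hF, hL₁⟩ :=
        ih (fun _ h => hL (List.mem_cons_of_mem _ h)) hlast'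
      rcases walkStep_cases (φ := φ) hD hs hM hM' hE with ⟨h1, h2⟩ | ⟨h1, h2, h3⟩
      · rw [h1]
        refine ⟨hM, hM', E :: L₁, F, L₂, rfl, hF, ?_⟩
        exact List.forall_mem_cons.2 ⟨h2, hL₁⟩
      · exact ⟨h1, h2, [], E, _, rfl, h3, by simp⟩

theorem falsified_rawClauses_getElem {V : Type} [DecidableEq V] {φ : List RawCnfClause}
    {g : V → RawVar} {L : ClauseList V} {i : ℕ} (hi : i < (rawClauses g L).length)
    (hi' : i < (L.map List.toFinset).length) :
    falsified n φ s D M (rawClauses g L)[i] = true ↔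
      ∀ l ∈ (L.map List.toFinset)[i], val n φ s D M (g l.1) = some (!l.2) := by
  rw [falsified_iff]
  simp only [rawClauses, List.getElem_map, List.mem_toFinset, List.forall_mem_map]

/-- The clause at which the walk ends is an axiom, as otherwise one of its premises would be falsified
after a query of the block of the resolved variable. -/
theorem exists_satisfies_of_isRefutation {φ : ClauseList (Fin n)}
    {π : ClauseList (RefVar n φ.length s)} (hD : IsRestriction n s (rawClauses rawVar π) D)
    (hs : 24 * n * n < s) (h : IsRefutation (Ref s φ.toCNF) (π.map List.toFinset)) :
    ∃ r ∈ walk n (rawClauses Fin.val φ) s D (rawClauses rawVar π),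
      r.2.1.length = n ∧ satisfies (rawClauses Fin.val φ) r.2.1 = true := by
  have hlast : (rawClauses rawVar π).getLast? = some [] := by
    have := h.last_empty
    rw [List.getLast?_map, Option.map_eq_some_iff] at this
    obtain ⟨C, h1, h2⟩ := this
    rw [List.toFinset_eq_empty_iff] at h2
    rw [rawClauses, List.getLast?_map, h1, h2]
    rfl
  obtain ⟨hM, hM', L₁, E, L₂, hπ, hE, hL₁⟩ :=
    walk_spec (φ := rawClauses Fin.val φ) hD hs (fun _ h => h) hlast
  generalize walk n (rawClauses Fin.val φ) s D (rawClauses rawVar π) = M at *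
  have hlen : (rawClauses rawVar π).length = (π.map List.toFinset).length := by simp [rawClauses]
  have hc : L₁.length < (rawClauses rawVar π).length := by rw [hπ]; simp
  have hnot : ∀ j : Fin (π.map List.toFinset).length, (j : ℕ) < L₁.length → ∀ B < s,
      ¬ ∀ l ∈ (π.map List.toFinset)[j],
        val n (rawClauses Fin.val φ) s D (query n s D M B) (rawVar l.1) = some (!l.2) := by
    intro j hj B hB hf
    rw [Fin.getElem_fin, ← falsified_rawClauses_getElem (j.2.trans_eq hlen.symm)] at hf
    have h1 : (rawClauses rawVar π)[(j : ℕ)]'(j.2.trans_eq hlen.symm) ∈ L₁ := by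
      simp only [hπ, List.getElem_append_left hj, List.getElem_mem]
    rw [hL₁ _ h1 B hB] at hf
    cases hf
  have hE' : (rawClauses rawVar π)[L₁.length] = E := by simp [hπ]
  -- Querying a block keeps the current clause falsified.
  have hquery : ∀ B < s, ∀ l ∈ (π.map List.toFinset)[L₁.length]'(hlen ▸ hc),
      val n (rawClauses Fin.val φ) s D (query n s D M B) (rawVar l.1) = some (!l.2) := by
    intro B hB
    rw [← falsified_rawClauses_getElem hc, hE']
    exact falsified_of_forall_mem hM (hM.query hD hs hM' hB) (fun r hr _ => subset_query B hr) hE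
  rcases h.derived ⟨L₁.length, hlen ▸ hc⟩ with h1 | ⟨j, hj, h1⟩ | ⟨j, k, hj, hk, x, A, B, h1, h2, h3⟩
  · refine exists_satisfies_of_refClause hD hM h1 ?_
    rw [Fin.getElem_fin, ← falsified_rawClauses_getElem hc, hE']
    exact hE
  · exact absurd (fun l hl => hquery 0 (by omega) l (h1 hl)) (hnot j hj 0 (by omega))
  · have hxs : (rawVar x).2.1 < s := by cases x <;> exact Fin.is_lt _
    have hx : ∃ b, val n (rawClauses Fin.val φ) s D (query n s D M (rawVar x).2.1)
        (rawVar x) = some b := by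
      cases hv : isEnable (rawVar x) with
      | true => exact ⟨_, val_of_isEnable hv⟩
      | false =>
        cases ho : off n s D (rawVar x).2.1 with
        | some b => exact ⟨b, val_of_off hv ho⟩
        | none =>
          obtain ⟨r, hr, h4⟩ := exists_mem_query (M := M) ho
          exact ⟨_, ((hM.query hD hs hM' hxs).val_eq_some_iff hv ho).2 ⟨r, hr, h4, rfl⟩⟩
    have hq := hquery _ hxs
    rw [Fin.getElem_fin] at h3
    rw [h3] at hq
    obtain ⟨b, hx⟩ := hx
    cases b with
    | false =>
      refine absurd ?_ (hnot j hj _ hxs)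
      rw [h1, Finset.forall_mem_insert]
      exact ⟨hx, fun l hl => hq l (Finset.mem_union_left _ hl)⟩
    | true =>
      refine absurd ?_ (hnot k hk _ hxs)
      rw [h2, Finset.forall_mem_insert]
      exact ⟨hx, fun l hl => hq l (Finset.mem_union_right _ hl)⟩

/-! ### Correctness of the algorithm -/

theorem mem_bruteForce {u : List Bool} {N : ℕ} (h : 2 ^ u.length ≤ N) :
    u ∈ bruteForce u.length N := by
  simp only [bruteForce, List.mem_map, List.mem_range]
  refine ⟨Nat.ofBits fun j : Fin u.length => u[j], (Nat.ofBits_lt_two_pow _).trans_le h, ?_⟩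
  refine List.ext_getElem (by simp) fun j h1 h2 => ?_
  rw [List.getElem_map, List.getElem_range, Nat.testBit_ofBits_lt _ _ h2]
  rfl

theorem satisfies_rawClauses_ofFn {φ : ClauseList (Fin n)} {α : Fin n → Bool} :
    satisfies (rawClauses Fin.val φ) (List.ofFn α) = true ↔ Satisfies α φ.toCNF := by
  simp only [satisfies, rawClauses, List.all_map, List.all_eq_true, Function.comp_apply,
    List.any_map, List.any_eq_true, Satisfies, SatisfiesClause, ClauseList.toCNF,
    List.mem_toFinset]
  constructor
  · intro h A
    simpa using h _ (φ.get_mem A)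
  · intro h C hC
    obtain ⟨A, rfl⟩ := List.get_of_mem hC
    simpa using h A

theorem isCorrectOutput_solve {φ : ClauseList (Fin n)} {π : ClauseList (RefVar n φ.length s)}
    (hs : n ^ 3 ≤ s) (h : IsRefutation (Ref s φ.toCNF) (π.map List.toFinset)) :
    ∃ y : Option (Fin n → Bool), IsCorrectOutput φ.toCNF y ∧
      ((solve n (rawClauses Fin.val φ) s (rawClauses rawVar π)).elim [false] fun u => true :: u) =
        encodeOutput y := by
  unfold solve
  cases hf : (candidates n (rawClauses Fin.val φ) s (rawClauses rawVar π)).find?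
      fun u => decide (u.length = n) && satisfies (rawClauses Fin.val φ) u with
  | some u =>
    have h1 := List.find?_some hf
    simp only [Bool.and_eq_true, decide_eq_true_eq] at h1
    obtain ⟨α, rfl⟩ : ∃ α : Fin n → Bool, u = List.ofFn α := by
      obtain ⟨rfl, -⟩ := h1
      exact ⟨u.get, (List.ofFn_get u).symm⟩
    exact ⟨some α, satisfies_rawClauses_ofFn.1 h1.2, rfl⟩
  | none =>
    refine ⟨none, ?_, rfl⟩
    rintro ⟨α, hα⟩
    rw [List.find?_eq_none] at hf
    simp only [Bool.and_eq_true, decide_eq_true_eq, not_and] at hf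
    by_cases hlong : 2 ^ n ≤ (rawClauses rawVar π).length + bruteForceBound
    · refine hf (List.ofFn α) ?_ (by simp) (satisfies_rawClauses_ofFn.2 hα)
      have := mem_bruteForce (u := List.ofFn α) (by simpa using hlong)
      rw [List.length_ofFn] at this
      exact List.mem_append_left _ this
    · have hn : 25 < n := by
        rw [← Nat.pow_lt_pow_iff_right (a := 2) (by omega)]
        change bruteForceBound < 2 ^ n
        omega
      have hs' : 24 * n * n < s := by
        refine lt_of_lt_of_le ?_ hs
        have : 24 * (n * n) < n * (n * n) := Nat.mul_lt_mul_of_pos_right (by omega) (by positivity)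
        calc 24 * n * n = 24 * (n * n) := by ring
          _ < n * (n * n) := this
          _ = n ^ 3 := by ring
      have hD := isRestriction_greedy (s := s) (π := rawClauses rawVar π) (n := n) (by omega) hs'
        (by omega)
      obtain ⟨r, hr, h1, h2⟩ := exists_satisfies_of_isRefutation hD hs' h
      exact hf r.2.1 (List.mem_append_right _ (List.mem_map_of_mem hr)) h1 h2

end ProofAnalysis

theorem mainTheorem1 : ProofAnalysis.InFP (ProofAnalysis.FPAPRes (fun n => n ^ 3)) := by
  refine ProofAnalysis.inFP_of_polyTime ProofAnalysis.PolyTime.analyze ?_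
  rintro x ⟨_, n, φ, s, π, _, h1, hs, hπ, -, hx⟩
  obtain rfl := (Prod.mk.inj hx).1
  obtain ⟨y, hy, e⟩ := ProofAnalysis.isCorrectOutput_solve hs hπ
  exact ⟨n, φ, s, π, y, h1, hs, hπ, hy, by rw [ProofAnalysis.analyze_encodeInput, e]⟩
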